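/- Let $n\ge 2$. A (cabled) linkage $\mathcal L=(L,\ell,V,\mu,F)$ in $\mathbb R^n$ consists of a finite graph $L$ (no loops or multiple edges) with vertex set $\mathcal V(\mathcal L)$ and edge set $\mathcal E$, a length function $\ell:\mathcal E\to(0,\infty)$, a set $V\subset\mathcal V(\mathcal L)$ of fixed vertices with a map $\mu:V\to\mathbb R^n$, and a set $F\subset\mathcal E$ of flexible edges. Its configuration space $\mathcal C(\mathcal L)\subset(\mathbb R^n)^{\mathcal V(\mathcal L)}$ is the set of all $\varphi:\mathcal V(\mathcal L)\to\mathbb R^n$ with $\varphi(v)=\mu(v)$ for $v\in V$, $|\varphi(v)-\varphi(w)|\le\ell(\overline{vw})$ for $\overline{vw}\in F$, and $|\varphi(v)-\varphi(w)|=\ell(\overline{vw})$ for $\overline{vw}\in\mathcal E\setminus F$. A subset of $\mathbb R^N$ is quasialgebraic if it is given by finitely many polynomial conditions $p_i=0$ and $q_j\ge 0$. For subsets $A,B$ of Euclidean spaces, a homeomorphism $g:A\to B$ is an analytic isomorphism if $g$ and $g^{-1}$ are both restrictions of real analytic maps defined on open neighbourhoods of $A$ and $B$ respectively. For $X\subset(\mathbb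 R^n)^k$ and $f:X\to(\mathbb R^n)^m$, the linkage $\mathcal L$ is a strong functional linkage for $f$ with domain $X$ if there are vertices $w_1,\dots,w_k$ and $v_1,\dots,v_m$ of $\mathcal L$ (repetitions allowed) such that, with $q_{\mathcal L}(\varphi)=(\varphi(w_1),\dots,\varphi(w_k))$ and $p_{\mathcal L}(\varphi)=(\varphi(v_1),\dots,\varphi(v_m))$ on $\mathcal C(\mathcal L)$, one has $q_{\mathcal L}(\mathcal C(\mathcal L))=X$, $p_{\mathcal L}=f\circ q_{\mathcal L}$, and $q_{\mathcal L}:\mathcal C(\mathcal L)\to X$ is an analytic isomorphism. Theorem. Let $n\ge 2$, let $X\subset(\mathbb R^n)^k$ be compact, and let $f:X\to(\mathbb R^n)^m$ be a map. Then the following are equivalent: 1. There is a strong functional linkage $\mathcal L$ for $f$ with domain $X$. 2. There are a quasialgebraic set $Y\subset\mathbb R^N$ for some $N$, and polynomial maps $q:Y\to X$ and $p:Y\to(\mathbb R^n)^m$ (restrictions of polynomials to $Y$), such that $p=f\circ q$ and $q$ is an analytic isomorphism from $Y$ onto $X$. -/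

import Mathlib

/-- A set in `ℝ^N` is quasialgebraic if it is given by finitely many polynomial equations
`p = 0` and finitely many weak polynomial inequalities `q ≥ 0`. -/
def IsQuasialgebraic {N : ℕ} (S : Set (Fin N → ℝ)) : Prop :=
  ∃ P Q : Finset (MvPolynomial (Fin N) ℝ),
    S = {x | (∀ p ∈ P, MvPolynomial.eval x p = 0) ∧ ∀ q ∈ Q, 0 ≤ MvPolynomial.eval x q}

/-- A map from a subset of `ℝ^N` to `(ℝ^n)^k` is polynomial if every coordinate of it is the
restriction of a polynomial. -/
def IsPolynomialMap {N n k : ℕ} {S : Set (Fin N → ℝ)}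
    (g : S → Fin k → EuclideanSpace ℝ (Fin n)) : Prop :=
  ∃ P : Fin k → Fin n → MvPolynomial (Fin N) ℝ,
    ∀ (x : S) (i : Fin k) (j : Fin n), g x i j = MvPolynomial.eval (x : Fin N → ℝ) (P i j)

/-- A map between subsets of normed spaces is analytic if it is the restriction of a map which is
analytic (locally given by power series of the ambient space) on an open neighbourhood of the
domain. `AnalyticOnNhd ℝ G A` says that `G` has a power series expansion, valid in an open ball of
the ambient space, about every point of `A`. -/
def IsAnalyticMap {E F : Type*} [NormedAddCommGroup E] [NormedSpace ℝ E]
    [NormedAddCommGroup F] [NormedSpace ℝ F] {A : Set E} {B : Set F} (g : A → B) : Prop :=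
  ∃ G : E → F, AnalyticOnNhd ℝ G A ∧ ∀ a : A, G a = g a

/-- An analytic isomorphism is a homeomorphism which is analytic with analytic inverse. -/
def IsAnalyticIso {E F : Type*} [NormedAddCommGroup E] [NormedSpace ℝ E]
    [NormedAddCommGroup F] [NormedSpace ℝ F] {A : Set E} {B : Set F} (g : A → B) : Prop :=
  ∃ h : A ≃ₜ B, (∀ a, h a = g a) ∧ IsAnalyticMap (fun a => h a) ∧ IsAnalyticMap (fun b => h.symm b)

/-- A (cabled) linkage in `ℝ^n`: a finite graph with a positive length for every edge, a set of
vertices fixed at prescribed points of `ℝ^n`, and a set of edges which are flexible cables rather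
than rigid rods. -/
structure CabledLinkage (n : ℕ) where
  Vert : Type
  [fintypeVert : Fintype Vert]
  graph : SimpleGraph Vert
  len : graph.edgeSet → ℝ
  len_pos : ∀ e, 0 < len e
  fixed : Set Vert
  pos : fixed → EuclideanSpace ℝ (Fin n)
  flexible : Set graph.edgeSet

attribute [instance] CabledLinkage.fintypeVert

namespace CabledLinkage

/-- The configuration space, as a subset of `(ℝ^n)^V`. -/
def config {n : ℕ} (L : CabledLinkage n) : Set (L.Vert → EuclideanSpace ℝ (Fin n)) :=
  {φ | (∀ v : L.fixed, φ v = L.pos v) ∧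
    ∀ (v w : L.Vert) (h : s(v, w) ∈ L.graph.edgeSet),
      (⟨s(v, w), h⟩ ∈ L.flexible → ‖φ v - φ w‖ ≤ L.len ⟨s(v, w), h⟩) ∧
      (⟨s(v, w), h⟩ ∉ L.flexible → ‖φ v - φ w‖ = L.len ⟨s(v, w), h⟩)}

/-- The map `φ ↦ (φ (w 1), …, φ (w k))` on the configuration space. -/
def vertexMap {n k : ℕ} (L : CabledLinkage n) (w : Fin k → L.Vert) (φ : L.config) :
    Fin k → EuclideanSpace ℝ (Fin n) :=
  fun i => (φ : L.Vert → EuclideanSpace ℝ (Fin n)) (w i)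

/-- With input vertices `w` and output vertices `v` (repetitions allowed), the linkage is
quasifunctional for `f` with domain `X`: the image of the input map is `X`, and the output map is
the composition of `f` with the input map. -/
def IsQuasifunctionalWith {n k m : ℕ} (L : CabledLinkage n)
    {X : Set (Fin k → EuclideanSpace ℝ (Fin n))} (f : X → Fin m → EuclideanSpace ℝ (Fin n))
    (w : Fin k → L.Vert) (v : Fin m → L.Vert) : Prop :=
  Set.range (L.vertexMap w) = X ∧
    ∀ (φ : L.config) (h : L.vertexMap w φ ∈ X), L.vertexMap v φ = f ⟨L.vertexMap w φ, h⟩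

/-- The linkage is strongly functional for `f` with domain `X`: for some choice of input and output
vertices it is quasifunctional for `f` with domain `X`, and the input map is an analytic isomorphism
from the configuration space onto its image. -/
def IsStronglyFunctional {n k m : ℕ} (L : CabledLinkage n)
    {X : Set (Fin k → EuclideanSpace ℝ (Fin n))}
    (f : X → Fin m → EuclideanSpace ℝ (Fin n)) : Prop :=
  ∃ (w : Fin k → L.Vert) (v : Fin m → L.Vert), L.IsQuasifunctionalWith f w v ∧
    IsAnalyticIso (Set.rangeFactorization (L.vertexMap w))

end CabledLinkage

/-! A configuration space is itself quasialgebraic, since squared distances are polynomials, and the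
maps to input and output vertices are coordinate projections; this gives 1 ⇒ 2.

For 2 ⇒ 1, `Y` is homeomorphic to the compact set `X`, hence bounded and contained in a cube `D`.
The aim is a linkage whose configurations are exactly the values on `Y` of an analytic map `Φ`, with
the components of `q` and `p` among its vertex functions. Its input map is then `q` read through
`Φ`, with inverse `Φ ∘ q⁻¹` (`CabledLinkage.isStronglyFunctional_of_image`).

Such a linkage is grown from one parametrized by `D` by adding only vertices that are uniquely
determined by the old ones and analytic on `D` (`Constructible.of_unique`); thus no spurious
configuration ever appears. Two gadgets suffice. Braced parallelograms add functions of constant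
norm, so all linear combinations of such functions are constructible
(`constructible_of_mem_rigidSpan`). A point at fixed distances from the origin and from a moving
point also has constant norm, and suitable sums and differences of its two possible positions lie on
a coordinate axis (`isRigid_two_circles`). These yield straight-line motion (`OnAxis.of_arc`),
inversion (`OnAxis.inv`) and change of axis; squares, products and all polynomials follow. Finally
each condition `c ≥ 0` becomes one cable, which cuts `D` down to `Y`. -/

/-- A set of maps `V → ℝ^n` cut out by prescribing positions of points, distances between points,
and (finitely many) upper bounds on distances between points. -/
def IsLinkageSet {n : ℕ} {V : Type} (S : Set (V → EuclideanSpace ℝ (Fin n))) : Prop :=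
  ∃ (F : Set (V × EuclideanSpace ℝ (Fin n))) (R C : Set (V × V × ℝ)), C.Finite ∧
    (∀ c ∈ R, 0 < c.2.2) ∧ (∀ c ∈ C, 0 < c.2.2) ∧
    S = {φ | (∀ c ∈ F, φ c.1 = c.2) ∧ (∀ c ∈ R, ‖φ c.1 - φ c.2.1‖ = c.2.2) ∧
      ∀ c ∈ C, ‖φ c.1 - φ c.2.1‖ ≤ c.2.2}

/-! ### Sets of configurations cut out by pins, rods and cables. -/

namespace IsLinkageSet

variable {n : ℕ} {V W : Type}

theorem fix (v : V) (p : EuclideanSpace ℝ (Fin n)) : IsLinkageSet {φ | φ v = p} :=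
  ⟨{(v, p)}, ∅, ∅, Set.finite_empty, by simp, by simp, by simp⟩

theorem rod (v w : V) {r : ℝ} (hr : 0 < r) :
    IsLinkageSet {φ : V → EuclideanSpace ℝ (Fin n) | ‖φ v - φ w‖ = r} :=
  ⟨∅, {(v, w, r)}, ∅, Set.finite_empty, by simpa, by simp, by simp⟩

theorem cable (v w : V) {r : ℝ} (hr : 0 < r) :
    IsLinkageSet {φ : V → EuclideanSpace ℝ (Fin n) | ‖φ v - φ w‖ ≤ r} :=
  ⟨∅, ∅, {(v, w, r)}, Set.finite_singleton _, by simp, by simpa, by simp⟩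

theorem iInter {ι : Type*} [Finite ι] {S : ι → Set (V → EuclideanSpace ℝ (Fin n))}
    (h : ∀ i, IsLinkageSet (S i)) : IsLinkageSet (⋂ i, S i) := by
  choose F R C hfin hR hC hS using h
  refine ⟨⋃ i, F i, ⋃ i, R i, ⋃ i, C i, Set.finite_iUnion hfin, ?_, ?_, ?_⟩
  · simp only [Set.mem_iUnion]; rintro c ⟨i, hc⟩; exact hR i c hc
  · simp only [Set.mem_iUnion]; rintro c ⟨i, hc⟩; exact hC i c hc
  · ext φ
    simp only [Set.mem_iInter, hS, Set.mem_ofPred_eq, Set.mem_iUnion]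
    constructor
    · intro h
      exact ⟨fun c ⟨i, hc⟩ => (h i).1 c hc, fun c ⟨i, hc⟩ => (h i).2.1 c hc,
        fun c ⟨i, hc⟩ => (h i).2.2 c hc⟩
    · rintro ⟨h1, h2, h3⟩ i
      exact ⟨fun c hc => h1 c ⟨i, hc⟩, fun c hc => h2 c ⟨i, hc⟩, fun c hc => h3 c ⟨i, hc⟩⟩

theorem inter {S T : Set (V → EuclideanSpace ℝ (Fin n))} (hS : IsLinkageSet S)
    (hT : IsLinkageSet T) : IsLinkageSet (S ∩ T) := by
  rw [Set.inter_eq_iInter]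
  exact iInter (by rintro (_ | _) <;> assumption)

theorem comp (f : V → W) {S : Set (V → EuclideanSpace ℝ (Fin n))} (hS : IsLinkageSet S) :
    IsLinkageSet {φ : W → EuclideanSpace ℝ (Fin n) | φ ∘ f ∈ S} := by
  obtain ⟨F, R, C, hfin, hR, hC, rfl⟩ := hS
  refine ⟨(fun c => (f c.1, c.2)) '' F, (fun c => (f c.1, f c.2.1, c.2.2)) '' R,
    (fun c => (f c.1, f c.2.1, c.2.2)) '' C, hfin.image _, ?_, ?_, ?_⟩
  · rintro _ ⟨c, hc, rfl⟩; exact hR c hc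
  · rintro _ ⟨c, hc, rfl⟩; exact hC c hc
  · ext φ
    simp only [Set.mem_ofPred_eq, Function.comp, Set.forall_mem_image]

/-- A nonempty linkage set is the configuration space of a linkage: a pair of vertices with several
constraints keeps only the strongest one. -/
theorem exists_linkage [Fintype V] {S : Set (V → EuclideanSpace ℝ (Fin n))} (hS : IsLinkageSet S)
    (hne : S.Nonempty) :
    ∃ (L : CabledLinkage n) (e : V ≃ L.Vert), L.config = {φ | φ ∘ e ∈ S} := by
  classical
  obtain ⟨F, R, C, hfin, hR, hC, rfl⟩ := hS
  obtain ⟨φ₀, hF₀, hR₀, hC₀⟩ := hne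
  let rel : V → V → Prop := fun v w => ∃ r, (v, w, r) ∈ R ∨ (w, v, r) ∈ R
  let bds : V → V → Set ℝ := fun v w => {r | (v, w, r) ∈ C ∨ (w, v, r) ∈ C}
  have rel_symm : ∀ v w, rel v w = rel w v := fun v w => by simp only [rel, or_comm]
  have bds_symm : ∀ v w, bds v w = bds w v := fun v w => by simp only [bds, or_comm]
  have bds_fin : ∀ v w, (bds v w).Finite := by
    intro v w
    refine (hfin.image (fun c => c.2.2)).subset fun r hr => ?_
    rcases hr with h | h
    · exact Set.mem_image_of_mem (fun c : V × V × ℝ => c.2.2) h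
    · exact Set.mem_image_of_mem (fun c : V × V × ℝ => c.2.2) h
  have rel_len : ∀ v w r, ((v, w, r) ∈ R ∨ (w, v, r) ∈ R) → ‖φ₀ v - φ₀ w‖ = r ∧ 0 < r := by
    rintro v w r (h | h)
    · exact ⟨hR₀ (v, w, r) h, hR (v, w, r) h⟩
    · exact ⟨(norm_sub_rev _ _).trans (hR₀ (w, v, r) h), hR (w, v, r) h⟩
  have bds_pos : ∀ v w, ∀ r ∈ bds v w, ‖φ₀ v - φ₀ w‖ ≤ r ∧ 0 < r := by
    rintro v w r (h | h)
    · exact ⟨hC₀ (v, w, r) h, hC (v, w, r) h⟩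
    · exact ⟨(norm_sub_rev _ _).trans_le (hC₀ (w, v, r) h), hC (w, v, r) h⟩
  let flex : Sym2 V → Prop :=
    Sym2.lift ⟨fun v w => ¬ rel v w, fun v w => by simp only [rel_symm v w]⟩
  -- The sample configuration `φ₀` makes the constraints on a pair consistent: all its rods have
  -- length `‖φ₀ v - φ₀ w‖` and its cables are at least that long, so a rod makes them redundant.
  -- Without a rod, finiteness makes the infimum of the cable lengths attained, hence positive.
  let ln : Sym2 V → ℝ := Sym2.lift ⟨fun v w => if rel v w then ‖φ₀ v - φ₀ w‖ else sInf (bds v w),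
    fun v w => by simp only [rel_symm v w, bds_symm v w, norm_sub_rev (φ₀ v) (φ₀ w)]⟩
  let G : SimpleGraph V :=
    { Adj := fun v w => v ≠ w ∧ (rel v w ∨ (bds v w).Nonempty)
      symm := ⟨fun v w h => ⟨h.1.symm, by rw [rel_symm, bds_symm]; exact h.2⟩⟩
      loopless := ⟨fun v h => h.1 rfl⟩ }
  have ln_pos : ∀ e : G.edgeSet, 0 < ln e := by
    rintro ⟨e, he⟩
    induction e with
    | h v w =>
      obtain ⟨-, h⟩ := (SimpleGraph.mem_edgeSet G).1 he
      change 0 < if rel v w then ‖φ₀ v - φ₀ w‖ else sInf (bds v w)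
      split_ifs with hr
      · obtain ⟨r, hr⟩ := hr
        rw [(rel_len v w r hr).1]
        exact (rel_len v w r hr).2
      · exact (bds_pos v w _ ((h.resolve_left hr).csInf_mem (bds_fin v w))).2
  refine ⟨⟨V, G, fun e => ln e, ln_pos, {v | ∃ p, (v, p) ∈ F}, fun v => φ₀ v,
    {e | flex e}⟩, Equiv.refl V, ?_⟩
  ext φ
  constructor
  · rintro ⟨h1, h2⟩
    have key : ∀ v w r, ((v, w, r) ∈ C ∨ (w, v, r) ∈ C) → ‖φ v - φ w‖ ≤ r := by
      intro v w r h
      obtain ⟨h3, h4⟩ := bds_pos v w r h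
      by_cases hvw : v = w
      · subst hvw; simpa using h4.le
      have := h2 v w ⟨hvw, Or.inr ⟨r, h⟩⟩
      by_cases hr : rel v w
      · have h5 : ‖φ v - φ w‖ = ln s(v, w) := this.2 (by simpa [flex] using hr)
        rw [h5]
        simpa [ln, hr] using h3
      · have h5 : ‖φ v - φ w‖ ≤ ln s(v, w) := this.1 (by simpa [flex] using hr)
        refine h5.trans ?_
        simpa [ln, hr] using csInf_le (bds_fin v w).bddBelow h
    refine ⟨?_, ?_, ?_⟩
    · rintro ⟨v, p⟩ hc
      exact (h1 ⟨v, p, hc⟩).trans (hF₀ _ hc)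
    · rintro ⟨v, w, r⟩ hc
      have hr : rel v w := ⟨r, Or.inl hc⟩
      have hl := rel_len v w r (Or.inl hc)
      have hvw : v ≠ w := by
        rintro rfl
        simp at hl
        linarith
      have h5 : ‖φ v - φ w‖ = ln s(v, w) :=
        (h2 v w ⟨hvw, Or.inl hr⟩).2 (by simpa [flex] using hr)
      change ‖φ v - φ w‖ = r
      rw [h5, ← hl.1]
      simp [ln, hr]
    · rintro ⟨v, w, r⟩ hc
      exact key v w r (Or.inl hc)
  · rintro ⟨h1, h2, h3⟩
    refine ⟨?_, ?_⟩
    · rintro ⟨v, p, hc⟩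
      exact (h1 _ hc).trans (hF₀ _ hc).symm
    · intro v w h
      obtain ⟨hvw, h⟩ := (SimpleGraph.mem_edgeSet G).1 h
      constructor
      · intro hr
        have hr : ¬ rel v w := hr
        change ‖φ v - φ w‖ ≤ ln s(v, w)
        have h4 : ln s(v, w) = sInf (bds v w) := by simp [ln, hr]
        rw [h4]
        rcases (h.resolve_left hr).csInf_mem (bds_fin v w) with h5 | h5
        · exact h3 (_, _, _) h5
        · rw [norm_sub_rev]; exact h3 (_, _, _) h5
      · intro hr
        have hr : rel v w := not_not.1 hr
        change ‖φ v - φ w‖ = ln s(v, w)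
        have h4 : ln s(v, w) = ‖φ₀ v - φ₀ w‖ := by simp [ln, hr]
        rw [h4]
        obtain ⟨r, h5⟩ := hr
        rw [(rel_len v w r h5).1]
        rcases h5 with h5 | h5
        · exact h2 (_, _, _) h5
        · rw [norm_sub_rev]; exact h2 (_, _, _) h5

end IsLinkageSet

/-! ### Strong functionality from an analytic parametrization. -/

/-- A linkage whose configuration space is an analytic image of `Y` is strongly functional
if the input vertices compute `q`. -/
theorem CabledLinkage.isStronglyFunctional_of_image {n k m N : ℕ} (L : CabledLinkage n)
    {X : Set (Fin k → EuclideanSpace ℝ (Fin n))} {f : X → Fin m → EuclideanSpace ℝ (Fin n)}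
    {Y : Set (Fin N → ℝ)} {q : Y → X} (hq : IsAnalyticIso q)
    {Φ : (Fin N → ℝ) → L.Vert → EuclideanSpace ℝ (Fin n)} (hΦ : AnalyticOnNhd ℝ Φ Y)
    (hL : L.config = Φ '' Y) {w : Fin k → L.Vert} {v : Fin m → L.Vert}
    (hw : ∀ (y : Y) i, Φ y (w i) = (q y : Fin k → EuclideanSpace ℝ (Fin n)) i)
    (hv : ∀ (y : Y) i, Φ y (v i) = f (q y) i) : L.IsStronglyFunctional f := by
  obtain ⟨h, hh, -, G, hG, hGh⟩ := hq
  have hmem : ∀ y : Y, Φ y ∈ L.config := fun y => hL ▸ ⟨y, y.2, rfl⟩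
  have hsurj : ∀ φ : L.config, ∃ y : Y, φ = ⟨Φ y, hmem y⟩ := by
    rintro ⟨φ, hφ⟩
    obtain ⟨y, hy, rfl⟩ := hL ▸ hφ
    exact ⟨⟨y, hy⟩, rfl⟩
  have hval : ∀ y : Y, L.vertexMap w ⟨Φ y, hmem y⟩ = q y := fun y => funext fun i => hw y i
  have hrange : Set.range (L.vertexMap w) = X := by
    ext x
    constructor
    · rintro ⟨φ, rfl⟩
      obtain ⟨y, rfl⟩ := hsurj φ
      rw [hval]; exact (q y).2
    · intro hx
      refine ⟨⟨Φ (h.symm ⟨x, hx⟩), hmem _⟩, ?_⟩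
      rw [hval, ← hh]
      simp
  refine ⟨w, v, ⟨hrange, ?_⟩, ?_⟩
  · intro φ hφ
    obtain ⟨y, rfl⟩ := hsurj φ
    funext i
    have : (⟨_, hφ⟩ : X) = q y := Subtype.ext (hval y)
    rw [this]
    exact hv y i
  · have hGq : ∀ y : Y, G (q y) = y := fun y => by rw [hGh, ← hh]; simp
    have hGY : ∀ x ∈ Set.range (L.vertexMap w), G x ∈ Y := by
      rintro _ ⟨φ, rfl⟩
      obtain ⟨y, rfl⟩ := hsurj φ
      rw [hval, hGq]; exact y.2
    have hGan : AnalyticOnNhd ℝ G (Set.range (L.vertexMap w)) := hrange ▸ hG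
    -- `G` extends the inverse of `q`, so `Φ ∘ G` is the analytic extension of the inverse of the
    -- input map.
    have hΦG : AnalyticOnNhd ℝ (Φ ∘ G) (Set.range (L.vertexMap w)) := hΦ.comp hGan hGY
    have hcomp : AnalyticOnNhd ℝ (fun (φ : L.Vert → EuclideanSpace ℝ (Fin n)) i => φ (w i))
        L.config := by
      intro φ _
      exact (ContinuousLinearMap.pi (R := ℝ) fun i : Fin k =>
        ContinuousLinearMap.proj (R := ℝ) (φ := fun _ : L.Vert => EuclideanSpace ℝ (Fin n))
          (w i)).analyticAt φ
    let H : L.config ≃ₜ Set.range (L.vertexMap w) :=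
      { toFun := Set.rangeFactorization (L.vertexMap w)
        invFun := fun x => ⟨Φ (G x), hmem ⟨G x, hGY x x.2⟩⟩
        left_inv := by
          intro φ
          obtain ⟨y, rfl⟩ := hsurj φ
          apply Subtype.ext
          change Φ (G (L.vertexMap w ⟨Φ y, hmem y⟩)) = Φ y
          rw [hval, hGq]
        right_inv := by
          rintro ⟨_, φ, rfl⟩
          obtain ⟨y, rfl⟩ := hsurj φ
          apply Subtype.ext
          change (fun i => Φ (G (L.vertexMap w ⟨Φ y, hmem y⟩)) (w i)) = L.vertexMap w ⟨Φ y, hmem y⟩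
          rw [hval, hGq]
          exact hval y
        continuous_toFun := (continuousOn_iff_continuous_domRestrict.1
          hcomp.continuousOn).subtype_mk _
        continuous_invFun := (continuousOn_iff_continuous_domRestrict.1
          hΦG.continuousOn).subtype_mk _ }
    exact ⟨H, fun _ => rfl, ⟨_, hcomp, fun _ => rfl⟩, ⟨_, hΦG, fun _ => rfl⟩⟩

/-! ### From linkages to quasialgebraic sets. -/

theorem isQuasialgebraic_of_finite {N : ℕ} {ι κ : Type*} [Finite ι] [Finite κ]
    (P : ι → MvPolynomial (Fin N) ℝ) (Q : κ → MvPolynomial (Fin N) ℝ) :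
    IsQuasialgebraic {x : Fin N → ℝ | (∀ i, MvPolynomial.eval x (P i) = 0) ∧
      ∀ i, 0 ≤ MvPolynomial.eval x (Q i)} := by
  refine ⟨(Set.finite_range P).toFinset, (Set.finite_range Q).toFinset, ?_⟩
  simp

/-- The configuration space of a linkage, in real coordinates, is quasialgebraic. -/
theorem CabledLinkage.isQuasialgebraic_config {n N : ℕ} (L : CabledLinkage n)
    (e : L.Vert × Fin n ≃ Fin N) :
    IsQuasialgebraic {x : Fin N → ℝ |
      (fun v => WithLp.toLp 2 fun j => x (e (v, j)) : L.Vert → EuclideanSpace ℝ (Fin n)) ∈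
        L.config} := by
  classical
  let E := {z : L.Vert × L.Vert // s(z.1, z.2) ∈ L.graph.edgeSet}
  let ed : E → L.graph.edgeSet := fun z => ⟨_, z.2⟩
  let d : E → MvPolynomial (Fin N) ℝ := fun z =>
    MvPolynomial.C (L.len (ed z) ^ 2) -
    ∑ j, (MvPolynomial.X (e (z.1.1, j)) - MvPolynomial.X (e (z.1.2, j))) ^ 2
  have hd : ∀ (z : E) (x : Fin N → ℝ), MvPolynomial.eval x (d z) = L.len (ed z) ^ 2 -
      ‖(WithLp.toLp 2 fun j => x (e (z.1.1, j)) : EuclideanSpace ℝ (Fin n)) -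
        WithLp.toLp 2 fun j => x (e (z.1.2, j))‖ ^ 2 := by
    intro z x
    simp [d, EuclideanSpace.norm_sq_eq]
  have := isQuasialgebraic_of_finite (N := N)
    (ι := (L.fixed × Fin n) ⊕ {z : E // ed z ∉ L.flexible})
    (κ := {z : E // ed z ∈ L.flexible})
    (Sum.elim (fun a => MvPolynomial.X (e (a.1, a.2)) - MvPolynomial.C (L.pos a.1 a.2))
      fun z => d z) (fun z => d z)
  convert this using 1
  ext x
  simp only [CabledLinkage.config, Set.mem_ofPred_eq, Sum.forall, Sum.elim_inl, Sum.elim_inr, hd]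
  simp only [map_sub, MvPolynomial.eval_X, MvPolynomial.eval_C, sub_eq_zero, sub_nonneg]
  have h1 : ∀ v : L.fixed, ((WithLp.toLp 2 fun j => x (e (v, j)) : EuclideanSpace ℝ (Fin n)) =
      L.pos v ↔ ∀ j, x (e (v, j)) = L.pos v j) := by
    intro v
    constructor
    · intro h j; rw [← h]
    · intro h; ext j; exact h j
  simp only [h1, Prod.forall, Subtype.forall]
  constructor
  · rintro ⟨a, b⟩
    refine ⟨⟨a, ?_⟩, ?_⟩
    · rintro ⟨⟨v, w⟩, h⟩ hf
      rw [(b v w h).2 hf]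
    · rintro ⟨⟨v, w⟩, h⟩ hf
      exact pow_le_pow_left₀ (norm_nonneg _) ((b v w h).1 hf) 2
  · rintro ⟨⟨a, b⟩, c⟩
    refine ⟨a, fun v w h => ⟨fun hf => ?_, fun hf => ?_⟩⟩
    · exact le_of_sq_le_sq (c ⟨(v, w), h⟩ hf) (L.len_pos _).le
    · exact ((sq_eq_sq₀ (L.len_pos _).le (norm_nonneg _)).1 (b ⟨(v, w), h⟩ hf)).symm

/-- Take for `Y` the configuration space in real coordinates; `q` and `p` are then coordinate
projections, and `q` is the input map up to a linear change of coordinates. -/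
theorem CabledLinkage.IsStronglyFunctional.exists_quasialgebraic {n k m : ℕ}
    {L : CabledLinkage n} {X : Set (Fin k → EuclideanSpace ℝ (Fin n))}
    {f : X → Fin m → EuclideanSpace ℝ (Fin n)} (hL : L.IsStronglyFunctional f) :
    ∃ (N : ℕ) (Y : Set (Fin N → ℝ)) (q : Y → X) (p : Y → Fin m → EuclideanSpace ℝ (Fin n)),
      IsQuasialgebraic Y ∧ IsPolynomialMap (fun y => (q y : Fin k → EuclideanSpace ℝ (Fin n))) ∧
      IsPolynomialMap p ∧ p = f ∘ q ∧ IsAnalyticIso q := by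
  classical
  obtain ⟨w, v, ⟨rfl, hf⟩, h, hh, ⟨G, hG, hGh⟩, G', hG', hGh'⟩ := hL
  let e : L.Vert × Fin n ≃ Fin (Fintype.card (L.Vert × Fin n)) := Fintype.equivFin _
  let c : (Fin (Fintype.card (L.Vert × Fin n)) → ℝ) ≃L[ℝ] (L.Vert → EuclideanSpace ℝ (Fin n)) :=
    LinearEquiv.toContinuousLinearEquiv
      { toFun := fun x v => WithLp.toLp 2 fun j => x (e (v, j))
        invFun := fun φ i => φ (e.symm i).1 (e.symm i).2
        map_add' := fun _ _ => rfl
        map_smul' := fun _ _ => rfl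
        left_inv := fun x => by ext i; simp
        right_inv := fun φ => by ext v j; simp }
  let Y : Set (Fin (Fintype.card (L.Vert × Fin n)) → ℝ) := {x | c x ∈ L.config}
  let t : Y ≃ₜ L.config := c.toHomeomorph.subtype (fun x => Iff.rfl)
  refine ⟨_, Y, fun y => h (t y), fun y => L.vertexMap v (t y), L.isQuasialgebraic_config e,
    ⟨fun i j => MvPolynomial.X (e (w i, j)), ?_⟩, ⟨fun i j => MvPolynomial.X (e (v i, j)), ?_⟩,
    ?_, t.trans h, fun _ => rfl, ⟨G ∘ c, ?_, ?_⟩, ⟨c.symm ∘ G', ?_, ?_⟩⟩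
  · intro x i j
    simp only [hh, MvPolynomial.eval_X]
    rfl
  · intro x i j
    simp only [MvPolynomial.eval_X]
    rfl
  · funext y
    rw [hf _ ⟨_, rfl⟩]
    simp only [Function.comp, hh]
    rfl
  · exact hG.comp (fun x _ => c.analyticAt x) (fun x hx => hx)
  · intro y
    exact hGh (t y)
  · intro x hx
    exact (c.symm.analyticAt _).comp (hG' x hx)
  · intro x
    change c.symm (G' x) = c.symm (h.symm x)
    rw [hGh']

/-! ### Vertex functions that can be added to a linkage. -/

section Constructible

variable {n : ℕ} {E : Type*} [NormedAddCommGroup E] [NormedSpace ℝ E]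

/-- The functions `γ v` on `D` are the vertex functions of a linkage whose configuration space is
parametrized by `D`. -/
def Realizes {V : Type} (D : Set E) (γ : V → E → EuclideanSpace ℝ (Fin n)) : Prop :=
  IsLinkageSet ((fun y v => γ v y) '' D) ∧ ∀ v, AnalyticOnNhd ℝ (γ v) D

/-- Every linkage parametrized by `D` with the functions in `B` among its vertex functions extends
to one which also has the vertex function `g`. -/
def Constructible (D : Set E) (B : Set (E → EuclideanSpace ℝ (Fin n)))
    (g : E → EuclideanSpace ℝ (Fin n)) : Prop :=
  ∀ (V : Type) [Finite V] (γ : V → E → EuclideanSpace ℝ (Fin n)), Realizes D γ →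
    (∀ b ∈ B, ∃ v, Set.EqOn (γ v) b D) →
    ∃ (V' : Type) (_ : Finite V') (γ' : V' → E → EuclideanSpace ℝ (Fin n)), Realizes D γ' ∧
      (∀ v, ∃ v', Set.EqOn (γ' v') (γ v) D) ∧ ∃ v', Set.EqOn (γ' v') g D

variable {D : Set E} {B : Set (E → EuclideanSpace ℝ (Fin n))}

theorem Constructible.of_mem {g : E → EuclideanSpace ℝ (Fin n)} (hg : g ∈ B) :
    Constructible D B g :=
  fun V hV γ hγ hB => ⟨V, hV, γ, hγ, fun v => ⟨v, fun _ _ => rfl⟩, hB g hg⟩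

/-- Each extension keeps the earlier vertex functions, so finitely many constructions can be carried
out in succession. -/
theorem Constructible.exists_family {ι : Type*} [Finite ι] {g : ι → E → EuclideanSpace ℝ (Fin n)}
    (hg : ∀ i, Constructible D B (g i)) {V : Type} [Finite V]
    {γ : V → E → EuclideanSpace ℝ (Fin n)} (hγ : Realizes D γ)
    (hB : ∀ b ∈ B, ∃ v, Set.EqOn (γ v) b D) :
    ∃ (V' : Type) (_ : Finite V') (γ' : V' → E → EuclideanSpace ℝ (Fin n)), Realizes D γ' ∧
      (∀ v, ∃ v', Set.EqOn (γ' v') (γ v) D) ∧ ∀ i, ∃ v', Set.EqOn (γ' v') (g i) D := by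
  classical
  have := Fintype.ofFinite ι
  suffices H : ∀ s : Finset ι, ∃ (V' : Type) (_ : Finite V')
      (γ' : V' → E → EuclideanSpace ℝ (Fin n)), Realizes D γ' ∧
      (∀ v, ∃ v', Set.EqOn (γ' v') (γ v) D) ∧ ∀ i ∈ s, ∃ v', Set.EqOn (γ' v') (g i) D by
    simpa using H Finset.univ
  intro s
  induction s using Finset.induction_on with
  | empty => exact ⟨V, inferInstance, γ, hγ, fun v => ⟨v, fun _ _ => rfl⟩, by simp⟩
  | insert i s _ ih =>
    obtain ⟨V₁, hV₁, γ₁, hγ₁, h₁, h₁s⟩ := ih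
    obtain ⟨V₂, hV₂, γ₂, hγ₂, h₂, h₂i⟩ := hg i V₁ γ₁ hγ₁ (fun b hb => by
      obtain ⟨v, hv⟩ := hB b hb
      obtain ⟨v', hv'⟩ := h₁ v
      exact ⟨v', hv'.trans hv⟩)
    refine ⟨V₂, hV₂, γ₂, hγ₂, fun v => ?_, fun j hj => ?_⟩
    · obtain ⟨v', hv'⟩ := h₁ v
      obtain ⟨v'', hv''⟩ := h₂ v'
      exact ⟨v'', hv''.trans hv'⟩
    · rcases Finset.mem_insert.1 hj with rfl | hj
      · exact h₂i
      · obtain ⟨v', hv'⟩ := h₁s j hj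
        obtain ⟨v'', hv''⟩ := h₂ v'
        exact ⟨v'', hv''.trans hv'⟩

/-- Functions which are determined uniquely by constraints that involve constructible functions are
constructible. -/
theorem Constructible.of_unique {ι κ : Type} [Finite ι] [Finite κ]
    {h : ι → E → EuclideanSpace ℝ (Fin n)} (hh : ∀ i, Constructible D B (h i))
    {A : κ → E → EuclideanSpace ℝ (Fin n)} (hA : ∀ k, AnalyticOnNhd ℝ (A k) D)
    {T : Set (ι ⊕ κ → EuclideanSpace ℝ (Fin n))} (hT : IsLinkageSet T)
    (hu : ∀ y ∈ D, ∀ a : κ → EuclideanSpace ℝ (Fin n),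
      Sum.elim (fun i => h i y) a ∈ T ↔ a = fun k => A k y) (k : κ) :
    Constructible D B (A k) := by
  intro V hV γ hγ hB
  obtain ⟨V', hV', γ', ⟨hγ', han⟩, hold, hnew⟩ := exists_family hh hγ hB
  choose c hc using hnew
  refine ⟨V' ⊕ κ, inferInstance, Sum.elim γ' A, ⟨?_, ?_⟩, fun v => ?_, Sum.inr k, fun _ _ => rfl⟩
  -- The old constraints are kept on `V'`, and `T` is imposed with its `ι`-vertices glued to the
  -- vertices `c i` that carry `h i`.
  · convert (hγ'.comp (Sum.inl : V' → V' ⊕ κ)).inter (hT.comp (Sum.map c (id : κ → κ))) using 1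
    ext ψ
    constructor
    · rintro ⟨y, hy, rfl⟩
      refine ⟨⟨y, hy, rfl⟩, ?_⟩
      have e : (fun v => Sum.elim γ' A v y) ∘ Sum.map c id =
          Sum.elim (fun i => h i y) fun k => A k y := by
        funext x
        rcases x with i | k
        · exact hc i hy
        · rfl
      change (fun v => Sum.elim γ' A v y) ∘ Sum.map c id ∈ T
      rw [e]
      exact (hu y hy _).2 rfl
    · rintro ⟨⟨y, hy, hψ⟩, h2⟩
      have h3 : ∀ v, ψ (Sum.inl v) = γ' v y := fun v => (congrFun hψ v).symm
      have h4 : (fun k => ψ (Sum.inr k)) = fun k => A k y := by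
        have e : Sum.elim (fun i => h i y) (fun k => ψ (Sum.inr k)) = ψ ∘ Sum.map c id := by
          funext x
          rcases x with i | k
          · exact ((h3 (c i)).trans (hc i hy)).symm
          · rfl
        refine (hu y hy _).1 ?_
        rw [e]
        exact h2
      refine ⟨y, hy, ?_⟩
      funext x
      rcases x with v | k
      · exact (h3 v).symm
      · exact (congrFun h4 k).symm
  · rintro (v | k)
    · exact han v
    · exact hA k
  · obtain ⟨v', hv'⟩ := hold v
    exact ⟨Sum.inl v', hv'⟩

theorem Constructible.const (p : EuclideanSpace ℝ (Fin n)) : Constructible D B fun _ => p :=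
  Constructible.of_unique (ι := Empty) (κ := Unit) (h := fun i => i.elim) (fun i => i.elim)
    (A := fun _ _ => p) (fun _ => analyticOnNhd_const) (IsLinkageSet.fix (Sum.inr ()) p)
    (fun _ _ _ => ⟨fun h => funext fun _ => h, fun h => congrFun h ()⟩) ()

/-- A point determined uniquely by rods and cables to constructible points. -/
theorem Constructible.of_unique_point {ι κ : Type} [Finite ι] [Finite κ]
    {g : ι → E → EuclideanSpace ℝ (Fin n)} (hg : ∀ i, Constructible D B (g i))
    {h : κ → E → EuclideanSpace ℝ (Fin n)} (hh : ∀ i, Constructible D B (h i))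
    {r : ι → ℝ} (hr : ∀ i, 0 < r i) {s : κ → ℝ} (hs : ∀ i, 0 < s i)
    {A : E → EuclideanSpace ℝ (Fin n)} (hA : AnalyticOnNhd ℝ A D)
    (hu : ∀ y ∈ D, ∀ a : EuclideanSpace ℝ (Fin n),
      ((∀ i, ‖a - g i y‖ = r i) ∧ ∀ i, ‖a - h i y‖ ≤ s i) ↔ a = A y) :
    Constructible D B A := by
  refine Constructible.of_unique (ι := ι ⊕ κ) (κ := Unit) (h := Sum.elim g h)
    (by rintro (i | i); exacts [hg i, hh i]) (A := fun _ => A) (fun _ => hA)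
    ((IsLinkageSet.iInter fun i => IsLinkageSet.rod (Sum.inr ()) (Sum.inl (Sum.inl i)) (hr i)).inter
      (IsLinkageSet.iInter fun i =>
        IsLinkageSet.cable (Sum.inr ()) (Sum.inl (Sum.inr i)) (hs i))) ?_ ()
  intro y hy a
  have := hu y hy (a ())
  simp only [Set.mem_inter_iff, Set.mem_iInter, Set.mem_ofPred_eq, Sum.elim_inl, Sum.elim_inr]
  rw [this]
  exact ⟨fun h => funext fun _ => h, fun h => congrFun h ()⟩

/-- Equality case of the triangle inequality. It lets rods force a vertex to be a midpoint, or two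
sides to be parallel. -/
theorem eq_of_norm_add_eq_two_mul {F : Type*} [NormedAddCommGroup F] [InnerProductSpace ℝ F]
    {x y : F} {r : ℝ} (hx : ‖x‖ = r) (hy : ‖y‖ = r) (hxy : ‖x + y‖ = 2 * r) : x = y := by
  have := parallelogram_law_with_norm ℝ x y
  rw [hx, hy, hxy] at this
  have h0 : ‖x - y‖ * ‖x - y‖ = 0 := by linarith
  exact sub_eq_zero.1 (norm_eq_zero.1 (mul_self_eq_zero.1 h0))

/-- The fourth vertex of a parallelogram with rigid sides, kept from folding by a rod which
joins the midpoints of two opposite sides. -/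
theorem Constructible.parallelogram {a b d : E → EuclideanSpace ℝ (Fin n)}
    (ha : Constructible D B a) (hb : Constructible D B b) (hd : Constructible D B d)
    (ha' : AnalyticOnNhd ℝ a D) (hb' : AnalyticOnNhd ℝ b D) (hd' : AnalyticOnNhd ℝ d D)
    {l s : ℝ} (hl : 0 < l) (hs : 0 < s) (hab : ∀ y ∈ D, ‖b y - a y‖ = l)
    (had : ∀ y ∈ D, ‖d y - a y‖ = s) : Constructible D B (b + d - a) := by
  let A : Fin 3 → E → EuclideanSpace ℝ (Fin n) :=
    ![(1 / 2 : ℝ) • (a + b), d + (1 / 2 : ℝ) • (b - a), b + d - a]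
  refine Constructible.of_unique (ι := Fin 3) (κ := Fin 3) (h := ![a, b, d]) (A := A)
    ?_ ?_ ((IsLinkageSet.rod (Sum.inr 0) (Sum.inl 0) (half_pos hl)).inter <|
      (IsLinkageSet.rod (Sum.inl 1) (Sum.inr 0) (half_pos hl)).inter <|
      (IsLinkageSet.rod (Sum.inr 1) (Sum.inl 2) (half_pos hl)).inter <|
      (IsLinkageSet.rod (Sum.inr 2) (Sum.inr 1) (half_pos hl)).inter <|
      (IsLinkageSet.rod (Sum.inr 2) (Sum.inl 2) hl).inter <|
      (IsLinkageSet.rod (Sum.inr 1) (Sum.inr 0) hs).inter <|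
      (IsLinkageSet.rod (Sum.inr 2) (Sum.inl 1) hs)) ?_ 2
  · intro i; fin_cases i <;> assumption
  · intro i
    fin_cases i
    · exact (ha'.add hb').const_smul
    · exact hd'.add (hb'.sub ha').const_smul
    · exact (hb'.add hd').sub ha'
  · intro y hy x
    have hab := hab y hy
    have had := had y hy
    simp only [Set.mem_inter_iff, Set.mem_ofPred_eq, Sum.elim_inl, Sum.elim_inr]
    simp only [Matrix.cons_val]
    constructor
    · rintro ⟨h1, h2, h3, h4, h5, h6, h7⟩
      have e1 : x 0 - a y = b y - x 0 := eq_of_norm_add_eq_two_mul h1 h2 (by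
        rw [show x 0 - a y + (b y - x 0) = b y - a y by abel, hab]; ring)
      have e2 : x 1 - d y = x 2 - x 1 := eq_of_norm_add_eq_two_mul h3 h4 (by
        rw [show x 1 - d y + (x 2 - x 1) = x 2 - d y by abel, h5]; ring)
      have f1 : (2 : ℝ) • x 0 = a y + b y := by
        rw [two_smul]; rw [sub_eq_sub_iff_add_eq_add] at e1; rw [e1]; abel
      have f2 : (2 : ℝ) • x 1 = d y + x 2 := by
        rw [two_smul]; rw [sub_eq_sub_iff_add_eq_add] at e2; rw [e2]; abel
      -- The sum of the two sides is twice the vector between the midpoints, so the bracing rod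
      -- gives it the maximal norm `2 * s`. This rules out the folded position.
      have e3 : d y - a y = x 2 - b y := eq_of_norm_add_eq_two_mul had h7 (by
        rw [show d y - a y + (x 2 - b y) = (d y + x 2) - (a y + b y) by abel, ← f1, ← f2,
          ← smul_sub, norm_smul, h6]; simp)
      have g2 : x 2 = b y + d y - a y := by
        rw [sub_eq_sub_iff_add_eq_add] at e3
        rw [eq_sub_iff_add_eq, ← e3, add_comm]
      have g0 : x 0 = (1 / 2 : ℝ) • (a y + b y) := by
        rw [← f1, smul_smul]; norm_num
      have g1 : x 1 = d y + (1 / 2 : ℝ) • (b y - a y) := by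
        have : x 1 = (1 / 2 : ℝ) • ((2 : ℝ) • x 1) := by rw [smul_smul]; norm_num
        rw [this, f2, g2]
        module
      funext i
      fin_cases i
      · exact g0
      · exact g1
      · exact g2
    · rintro rfl
      have n2 : ‖(1 / 2 : ℝ) • (b y - a y)‖ = l / 2 := by
        rw [norm_smul, hab, Real.norm_of_nonneg (by norm_num)]; ring
      have e0 : A 0 y = (1 / 2 : ℝ) • (a y + b y) := rfl
      have e1 : A 1 y = d y + (1 / 2 : ℝ) • (b y - a y) := rfl
      have e2 : A 2 y = b y + d y - a y := rfl
      beta_reduce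
      rw [e0, e1, e2]
      refine ⟨?_, ?_, ?_, ?_, ?_, ?_, ?_⟩
      · rw [← n2]; congr 1; module
      · rw [← n2]; congr 1; module
      · rw [← n2]; congr 1; module
      · rw [← n2]; congr 1; module
      · rw [← hab]; congr 1; module
      · rw [← had]; congr 1; module
      · rw [← had]; congr 1; module

/-! ### Linear combinations of functions of constant norm. -/

/-- Constructible analytic functions of constant positive norm. -/
def IsRigid (D : Set E) (B : Set (E → EuclideanSpace ℝ (Fin n)))
    (g : E → EuclideanSpace ℝ (Fin n)) : Prop :=
  Constructible D B g ∧ AnalyticOnNhd ℝ g D ∧ ∃ l, 0 < l ∧ ∀ y ∈ D, ‖g y‖ = l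

theorem IsRigid.const {p : EuclideanSpace ℝ (Fin n)} (hp : p ≠ 0) : IsRigid D B fun _ => p :=
  ⟨Constructible.const p, analyticOnNhd_const, ‖p‖, norm_pos_iff.2 hp, fun _ _ => rfl⟩

/-- The spheres of radii `|c| * l` about `0` and `|c - 1| * l` about `g y` are tangent, and `c • g
y` is their only common point. -/
theorem IsRigid.smul {g : E → EuclideanSpace ℝ (Fin n)} (hg : IsRigid D B g) {c : ℝ}
    (hc : c ≠ 0) : IsRigid D B (c • g) := by
  obtain ⟨h1, h2, l, hl, h3⟩ := hg
  have hcl : 0 < |c| * l := mul_pos (abs_pos.2 hc) hl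
  have hn : ∀ y ∈ D, ‖(c • g) y‖ = |c| * l := fun y hy => by
    rw [Pi.smul_apply, norm_smul, h3 y hy, Real.norm_eq_abs]
  refine ⟨?_, h2.const_smul, |c| * l, hcl, hn⟩
  -- Rods need positive length, so the second sphere must not degenerate.
  by_cases hc1 : c = 1
  · subst hc1; simpa using h1
  have hcl' : 0 < |c - 1| * l := mul_pos (abs_pos.2 (sub_ne_zero.2 hc1)) hl
  refine Constructible.of_unique_point (ι := Fin 2) (κ := Empty) (g := ![fun _ => 0, g])
    (r := ![|c| * l, |c - 1| * l]) (h := fun i => i.elim) (s := fun i => i.elim)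
    ?_ (fun i => i.elim) ?_ (fun i => i.elim) h2.const_smul ?_
  · intro i
    fin_cases i
    exacts [Constructible.const 0, h1]
  · intro i
    fin_cases i
    exacts [hcl, hcl']
  · intro y hy a
    have hl := h3 y hy
    simp only [Fin.forall_fin_two, Matrix.cons_val_zero, Matrix.cons_val_one, sub_zero,
      IsEmpty.forall_iff, and_true, Pi.smul_apply]
    constructor
    · rintro ⟨e1, e2⟩
      have e1' : ‖a‖ ^ 2 = c ^ 2 * l ^ 2 := by rw [e1, mul_pow, sq_abs]
      have e2' : ‖a - g y‖ ^ 2 = (c - 1) ^ 2 * l ^ 2 := by rw [e2, mul_pow, sq_abs]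
      rw [norm_sub_sq_real, hl, e1'] at e2'
      have : ‖a - c • g y‖ ^ 2 = 0 := by
        rw [norm_sub_sq_real, inner_smul_right, norm_smul, mul_pow, Real.norm_eq_abs, sq_abs, hl,
          e1']
        linear_combination c * e2'
      exact sub_eq_zero.1 (norm_eq_zero.1 (pow_eq_zero_iff two_ne_zero |>.1 this))
    · rintro rfl
      refine ⟨hn y hy, ?_⟩
      rw [show c • g y - g y = (c - 1) • g y by module, norm_smul, hl, Real.norm_eq_abs]

/-- Finite sums of rigid functions. -/
inductive IsRigidSum (D : Set E) (B : Set (E → EuclideanSpace ℝ (Fin n))) :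
    (E → EuclideanSpace ℝ (Fin n)) → Prop
  | zero : IsRigidSum D B 0
  | add {g r} : IsRigidSum D B g → IsRigid D B r → IsRigidSum D B (g + r)

theorem IsRigidSum.analyticOnNhd {g : E → EuclideanSpace ℝ (Fin n)} (hg : IsRigidSum D B g) :
    AnalyticOnNhd ℝ g D := by
  induction hg with
  | zero => exact analyticOnNhd_const
  | add _ hr ih => exact ih.add hr.2.1

/-- The points `g`, `g + s`, `g + r`, `g + s + r` form a parallelogram whose sides have constant
lengths. For the induction to supply `g + r` as well as `g`, the claim must cover one further
arbitrary rigid summand. -/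
theorem IsRigidSum.constructible {g : E → EuclideanSpace ℝ (Fin n)} (hg : IsRigidSum D B g) :
    Constructible D B g := by
  suffices H : Constructible D B g ∧ ∀ r, IsRigid D B r → Constructible D B (g + r) from H.1
  induction hg with
  | zero => exact ⟨Constructible.const 0, fun r hr => by simpa using hr.1⟩
  | @add g s hg hs ih =>
    have hgs := ih.2 s hs
    refine ⟨hgs, fun r hr => ?_⟩
    have hga := hg.analyticOnNhd
    obtain ⟨l, hl, hsl⟩ := hs.2.2
    obtain ⟨m, hm, hrm⟩ := hr.2.2
    have := ih.1.parallelogram hgs (ih.2 r hr) hga (hga.add hs.2.1) (hga.add hr.2.1) hl hm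
      (fun y hy => by simpa using hsl y hy) (fun y hy => by simpa using hrm y hy)
    convert this using 1
    abel

/-- The space of linear combinations of rigid functions. -/
def rigidSpan (D : Set E) (B : Set (E → EuclideanSpace ℝ (Fin n))) :
    Submodule ℝ (E → EuclideanSpace ℝ (Fin n)) :=
  Submodule.span ℝ {g | IsRigid D B g}

theorem IsRigid.mem_rigidSpan {g : E → EuclideanSpace ℝ (Fin n)} (hg : IsRigid D B g) :
    g ∈ rigidSpan D B :=
  Submodule.subset_span hg

theorem const_mem_rigidSpan (p : EuclideanSpace ℝ (Fin n)) : (fun _ => p) ∈ rigidSpan D B := by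
  by_cases hp : p = 0
  · subst hp; exact Submodule.zero_mem _
  · exact (IsRigid.const hp).mem_rigidSpan

/-- Rigid sums grow by one summand at a time, hence the accumulator `h` and the scalar `c`. Terms
with coefficient zero are dropped because rigid functions have positive norm. -/
theorem isRigidSum_of_mem_rigidSpan {g : E → EuclideanSpace ℝ (Fin n)}
    (hg : g ∈ rigidSpan D B) : IsRigidSum D B g := by
  suffices H : ∀ (c : ℝ) (h : E → EuclideanSpace ℝ (Fin n)), IsRigidSum D B h →
      IsRigidSum D B (h + c • g) by simpa using H 1 0 IsRigidSum.zero
  induction hg using Submodule.span_induction with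
  | mem r hr =>
    intro c h hh
    by_cases hc : c = 0
    · simpa [hc] using hh
    · exact hh.add (IsRigid.smul hr hc)
  | zero => intro c h hh; simpa using hh
  | add g₁ g₂ _ _ ih₁ ih₂ =>
    intro c h hh
    rw [smul_add, ← add_assoc]
    exact ih₂ c _ (ih₁ c h hh)
  | smul a g _ ih =>
    intro c h hh
    rw [smul_smul]
    exact ih _ h hh

theorem constructible_of_mem_rigidSpan {g : E → EuclideanSpace ℝ (Fin n)}
    (hg : g ∈ rigidSpan D B) : Constructible D B g :=
  (isRigidSum_of_mem_rigidSpan hg).constructible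

theorem analyticOnNhd_of_mem_rigidSpan {g : E → EuclideanSpace ℝ (Fin n)}
    (hg : g ∈ rigidSpan D B) : AnalyticOnNhd ℝ g D :=
  (isRigidSum_of_mem_rigidSpan hg).analyticOnNhd

end Constructible

/-! ### Two circles in a coordinate plane. -/

section Plane

variable {n : ℕ} {a b : Fin n}

theorem EuclideanSpace.norm_sq_plane (hab : a ≠ b) (u v : ℝ) :
    ‖u • EuclideanSpace.single a (1 : ℝ) + v • EuclideanSpace.single b 1‖ ^ 2 = u ^ 2 + v ^ 2 := by
  rw [norm_add_sq_real, norm_smul, norm_smul, real_inner_smul_left, real_inner_smul_right]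
  simp [EuclideanSpace.inner_single_right, hab.symm]

theorem EuclideanSpace.eq_plane {w : EuclideanSpace ℝ (Fin n)} (hab : a ≠ b)
    (hw : ∀ i, i ≠ a → i ≠ b → w i = 0) :
    w = w a • EuclideanSpace.single a (1 : ℝ) + w b • EuclideanSpace.single b 1 := by
  ext i
  by_cases ha : i = a
  · subst ha; simp [hab]
  by_cases hb : i = b
  · subst hb; simp [ha]
  simp [hw i ha hb, ha, hb]

theorem EuclideanSpace.norm_sub_single_sq (w : EuclideanSpace ℝ (Fin n)) (i : Fin n) (c : ℝ) :
    ‖w - c • EuclideanSpace.single i (1 : ℝ)‖ ^ 2 = ‖w‖ ^ 2 - 2 * (c * w i) + c ^ 2 := by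
  rw [norm_sub_sq_real, norm_smul, real_inner_smul_right]
  simp [EuclideanSpace.inner_single_right]

/-- Intersection of two circles in a plane; the sign condition selects one of the two points. -/
theorem two_circles_unique {α β c p₁ p₂ x z u v : ℝ} (hα : 0 < α)
    (h₁ : (x ^ 2 + z ^ 2) * (p₁ ^ 2 + p₂ ^ 2) = α ^ 2)
    (h₂ : 2 * x * (p₁ ^ 2 + p₂ ^ 2) = p₁ ^ 2 + p₂ ^ 2 + α ^ 2 - β ^ 2)
    (hneg : c * (x * p₂ - z * p₁) < 0) (hu : u ^ 2 + v ^ 2 = α ^ 2)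
    (hv : (u - p₁) ^ 2 + (v - p₂) ^ 2 = β ^ 2) (hc : 0 ≤ c * v) :
    u = x * p₁ - z * p₂ ∧ v = x * p₂ + z * p₁ := by
  have hS : p₁ ^ 2 + p₂ ^ 2 ≠ 0 := by
    intro h
    rw [h, mul_zero] at h₁
    exact (pow_pos hα 2).ne h₁
  have hdot : u * p₁ + v * p₂ = x * (p₁ ^ 2 + p₂ ^ 2) := by linarith
  -- In complex notation the claim is `u + iv = (x + iz)(p₁ + ip₂)`. Lagrange's identity determines
  -- the cross product of `p` and `(u, v)` up to sign; the other sign replaces `z` by `-z` and is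
  -- excluded by `hneg`.
  have hcross : (v * p₁ - u * p₂ - z * (p₁ ^ 2 + p₂ ^ 2)) *
      (v * p₁ - u * p₂ + z * (p₁ ^ 2 + p₂ ^ 2)) = 0 := by
    linear_combination (p₁ ^ 2 + p₂ ^ 2) * hu - (p₁ ^ 2 + p₂ ^ 2) * h₁ -
      (u * p₁ + v * p₂ + x * (p₁ ^ 2 + p₂ ^ 2)) * hdot
  rcases mul_eq_zero.1 hcross with h | h
  · constructor
    · apply mul_right_cancel₀ hS; linear_combination p₁ * hdot - p₂ * h
    · apply mul_right_cancel₀ hS; linear_combination p₂ * hdot + p₁ * h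
  · have : v = x * p₂ - z * p₁ := by
      apply mul_right_cancel₀ hS; linear_combination p₂ * hdot + p₁ * h
    rw [this] at hc
    exact absurd hneg hc.not_gt

end Plane

theorem AnalyticAt.sqrt_of_pos {E : Type*} [NormedAddCommGroup E] [NormedSpace ℝ E] {f : E → ℝ}
    {x : E} (hf : AnalyticAt ℝ f x) (hx : 0 < f x) : AnalyticAt ℝ (fun y => √(f y)) x :=
  AnalyticAt.fun_comp (Real.contDiffAt_sqrt hx.ne').analyticAt hf

/-! ### Arithmetic on a coordinate axis. -/

section Gadgets

variable {n : ℕ} {a b : Fin n} {E : Type*} [NormedAddCommGroup E] [NormedSpace ℝ E] {D : Set E}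
  {B : Set (E → EuclideanSpace ℝ (Fin n))}

theorem Constructible.congr {f g : E → EuclideanSpace ℝ (Fin n)} (hf : Constructible D B f)
    (h : Set.EqOn f g D) : Constructible D B g := by
  intro V hV γ hγ hB
  obtain ⟨V', hV', γ', h1, h2, v', hv'⟩ := hf V γ hγ hB
  exact ⟨V', hV', γ', h1, h2, v', hv'.trans h⟩

/-- One of the two vertices at given distances from the origin and from a moving point of a
coordinate plane, within this plane. -/
theorem isRigid_two_circles (hab : a ≠ b) {p₁ p₂ x z : E → ℝ} {α β c : ℝ} (hα : 0 < α)
    (hβ : 0 < β) (hc : c ^ 2 = 1)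
    (hP : Constructible D B fun y =>
      p₁ y • EuclideanSpace.single a (1 : ℝ) + p₂ y • EuclideanSpace.single b (1 : ℝ))
    (hp₁ : AnalyticOnNhd ℝ p₁ D) (hp₂ : AnalyticOnNhd ℝ p₂ D) (hx : AnalyticOnNhd ℝ x D)
    (hz : AnalyticOnNhd ℝ z D)
    (h₁ : ∀ y ∈ D, (x y ^ 2 + z y ^ 2) * (p₁ y ^ 2 + p₂ y ^ 2) = α ^ 2)
    (h₂ : ∀ y ∈ D, 2 * x y * (p₁ y ^ 2 + p₂ y ^ 2) = p₁ y ^ 2 + p₂ y ^ 2 + α ^ 2 - β ^ 2)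
    (hpos : ∀ y ∈ D, 0 < c * (x y * p₂ y + z y * p₁ y))
    (hneg : ∀ y ∈ D, c * (x y * p₂ y - z y * p₁ y) < 0) :
    IsRigid D B fun y => (x y * p₁ y - z y * p₂ y) • EuclideanSpace.single a (1 : ℝ) +
      (x y * p₂ y + z y * p₁ y) • EuclideanSpace.single b (1 : ℝ) := by
  have han : AnalyticOnNhd ℝ (fun y => (x y * p₁ y - z y * p₂ y) •
      EuclideanSpace.single a (1 : ℝ) +
      (x y * p₂ y + z y * p₁ y) • EuclideanSpace.single b (1 : ℝ)) D :=
    (((hx.mul hp₁).sub (hz.mul hp₂)).smul analyticOnNhd_const).add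
      (((hx.mul hp₂).add (hz.mul hp₁)).smul analyticOnNhd_const)
  have hnorm : ∀ y ∈ D, ‖(x y * p₁ y - z y * p₂ y) • EuclideanSpace.single a (1 : ℝ) +
      (x y * p₂ y + z y * p₁ y) • EuclideanSpace.single b (1 : ℝ)‖ = α := by
    intro y hy
    rw [← sq_eq_sq₀ (norm_nonneg _) hα.le, EuclideanSpace.norm_sq_plane hab, ← h₁ y hy]
    ring
  refine ⟨?_, han, α, hα, hnorm⟩
  have hρ : 0 < √(α ^ 2 + 1) := Real.sqrt_pos.2 (by positivity)
  have hρ2 : √(α ^ 2 + 1) ^ 2 = α ^ 2 + 1 := Real.sq_sqrt (by positivity)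
  -- Once `‖w‖ = α`, distance `√(α ^ 2 + 1)` from a basis vector `e_i` means `w i = 0`, which
  -- confines `w` to the plane; a cable of the same length to `c • e_b` means `0 ≤ c * w b`, which
  -- selects the side.
  let g : Fin n → E → EuclideanSpace ℝ (Fin n) := fun i => if i = a then fun _ => 0 else
    if i = b then fun y => p₁ y • EuclideanSpace.single a (1 : ℝ) +
      p₂ y • EuclideanSpace.single b (1 : ℝ)
    else fun _ => (1 : ℝ) • EuclideanSpace.single i (1 : ℝ)
  let r : Fin n → ℝ := fun i => if i = a then α else if i = b then β else √(α ^ 2 + 1)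
  refine Constructible.of_unique_point (ι := Fin n) (κ := Unit) (g := g) (r := r)
    (h := fun _ _ => c • EuclideanSpace.single b (1 : ℝ)) (s := fun _ => √(α ^ 2 + 1))
    ?_ (fun _ => Constructible.const _) ?_ (fun _ => hρ) han ?_
  · intro i
    simp only [g]
    split_ifs
    exacts [Constructible.const _, hP, Constructible.const _]
  · intro i
    simp only [r]
    split_ifs <;> assumption
  · intro y hy w
    have ga : g a y = 0 := by simp [g]
    have gb : g b y = p₁ y • EuclideanSpace.single a (1 : ℝ) +
      p₂ y • EuclideanSpace.single b (1 : ℝ) := by simp [g, hab.symm]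
    have gi : ∀ i, i ≠ a → i ≠ b → g i y = (1 : ℝ) • EuclideanSpace.single i (1 : ℝ) := by
      intro i h h'; simp [g, h, h']
    have ra : r a = α := by simp [r]
    have rb : r b = β := by simp [r, hab.symm]
    have ri : ∀ i, i ≠ a → i ≠ b → r i = √(α ^ 2 + 1) := by
      intro i h h'; simp [r, h, h']
    constructor
    · rintro ⟨hr, hs⟩
      have e1 := hr a
      rw [ga, ra, sub_zero] at e1
      have hwi : ∀ i, i ≠ a → i ≠ b → w i = 0 := by
        intro i hi hi'
        have := hr i
        rw [gi i hi hi', ri i hi hi', ← sq_eq_sq₀ (norm_nonneg _) hρ.le,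
          EuclideanSpace.norm_sub_single_sq, hρ2, e1] at this
        linarith
      have hw := EuclideanSpace.eq_plane hab hwi
      have e2 := hr b
      rw [gb, rb, ← sq_eq_sq₀ (norm_nonneg _) hβ.le, hw, add_sub_add_comm, ← sub_smul, ← sub_smul,
        EuclideanSpace.norm_sq_plane hab] at e2
      have e3 := pow_le_pow_left₀ (norm_nonneg _) (hs ()) 2
      rw [EuclideanSpace.norm_sub_single_sq, hρ2, e1, hc] at e3
      rw [← sq_eq_sq₀ (norm_nonneg _) hα.le, hw, EuclideanSpace.norm_sq_plane hab] at e1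
      obtain ⟨hu, hv⟩ := two_circles_unique hα (h₁ y hy) (h₂ y hy) (hneg y hy) e1 e2 (by linarith)
      rw [← hu, ← hv]
      exact hw
    · intro hw
      have hn : ‖w‖ = α := hw ▸ hnorm y hy
      have hwi : ∀ i, i ≠ a → i ≠ b → w i = 0 := by
        intro i hi hi'
        rw [hw]
        simp [hi, hi']
      have hwb : w b = x y * p₂ y + z y * p₁ y := by
        rw [hw]; simp [hab.symm]
      refine ⟨fun i => ?_, fun _ => ?_⟩
      · by_cases hi : i = a
        · subst hi; rw [ga, ra, sub_zero, hn]
        by_cases hi' : i = b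
        · subst hi'
          rw [gb, rb, ← sq_eq_sq₀ (norm_nonneg _) hβ.le, hw, add_sub_add_comm, ← sub_smul,
            ← sub_smul, EuclideanSpace.norm_sq_plane hab]
          linear_combination h₁ y hy - h₂ y hy
        · rw [gi i hi hi', ri i hi hi', ← sq_eq_sq₀ (norm_nonneg _) hρ.le,
            EuclideanSpace.norm_sub_single_sq, hρ2, hn, hwi i hi hi']
          ring
      · refine le_of_sq_le_sq ?_ hρ.le
        rw [EuclideanSpace.norm_sub_single_sq, hρ2, hn, hc, hwb]
        linarith [hpos y hy]

/-- On `D`, the multiple `f y` of a coordinate vector is a linear combination of rigid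
functions. -/
def OnAxis (D : Set E) (B : Set (E → EuclideanSpace ℝ (Fin n))) (a : Fin n) (f : E → ℝ) : Prop :=
  ∃ g ∈ rigidSpan D B, ∀ y ∈ D, g y = f y • EuclideanSpace.single a (1 : ℝ)

namespace OnAxis

variable {f g : E → ℝ}

theorem congr (hf : OnAxis D B a f) (h : ∀ y ∈ D, f y = g y) : OnAxis D B a g := by
  obtain ⟨F, hF, hFf⟩ := hf
  exact ⟨F, hF, fun y hy => by rw [hFf y hy, h y hy]⟩

theorem const (c : ℝ) : OnAxis D B a fun _ => c :=
  ⟨_, const_mem_rigidSpan (c • EuclideanSpace.single a 1), fun _ _ => rfl⟩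

theorem add (hf : OnAxis D B a f) (hg : OnAxis D B a g) : OnAxis D B a fun y => f y + g y := by
  obtain ⟨F, hF, hFf⟩ := hf
  obtain ⟨G, hG, hGg⟩ := hg
  exact ⟨F + G, add_mem hF hG, fun y hy => by rw [Pi.add_apply, hFf y hy, hGg y hy, add_smul]⟩

theorem smul (c : ℝ) (hf : OnAxis D B a f) : OnAxis D B a fun y => c * f y := by
  obtain ⟨F, hF, hFf⟩ := hf
  exact ⟨c • F, Submodule.smul_mem _ c hF,
    fun y hy => by rw [Pi.smul_apply, hFf y hy, smul_smul]⟩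

theorem sub (hf : OnAxis D B a f) (hg : OnAxis D B a g) : OnAxis D B a fun y => f y - g y :=
  (hf.add (hg.smul (-1))).congr fun y _ => by ring

theorem constructible (hf : OnAxis D B a f) :
    Constructible D B fun y => f y • EuclideanSpace.single a (1 : ℝ) := by
  obtain ⟨F, hF, hFf⟩ := hf
  exact (constructible_of_mem_rigidSpan hF).congr hFf

/-- `f` is controlled only on `D`, whereas analyticity concerns a neighbourhood; quotients and
square roots are therefore formed from this representative. -/
theorem exists_analytic (hf : OnAxis D B a f) :
    ∃ f' : E → ℝ, AnalyticOnNhd ℝ f' D ∧ ∀ y ∈ D, f' y = f y := by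
  obtain ⟨F, hF, hFf⟩ := hf
  refine ⟨fun y => F y a, fun y hy => ?_, fun y hy => by simp [hFf y hy]⟩
  exact ((EuclideanSpace.proj a : EuclideanSpace ℝ (Fin n) →L[ℝ] ℝ).analyticAt _).comp
    (analyticOnNhd_of_mem_rigidSpan hF y hy)

theorem exists_scale (hD : IsCompact D) (hf : OnAxis D B a f) :
    ∃ ε : ℝ, 0 < ε ∧ ∀ y ∈ D, |ε * f y| ≤ 1 / 2 := by
  obtain ⟨f', hf', hff'⟩ := hf.exists_analytic
  obtain ⟨M, hM⟩ := hD.exists_bound_of_continuousOn hf'.continuousOn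
  have hM1 : 0 < |M| + 1 := by positivity
  refine ⟨1 / (2 * (|M| + 1)), by positivity, fun y hy => ?_⟩
  have h1 : |f y| ≤ |M| + 1 := by
    have := hM y hy
    rw [hff' y hy, Real.norm_eq_abs] at this
    linarith [le_abs_self M]
  rw [abs_mul, abs_of_pos (by positivity), div_mul_eq_mul_div, one_mul,
    div_le_div_iff₀ (by positivity) two_pos]
  linarith

theorem constructible_plane (hf : OnAxis D B a f) (b : Fin n) :
    Constructible D B fun y => f y • EuclideanSpace.single a (1 : ℝ) +
      (fun _ => (0 : ℝ)) y • EuclideanSpace.single b (1 : ℝ) :=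
  hf.constructible.congr fun y _ => by simp

/-- For `1 < p < 3` the circle of radius 2 about the origin meets the circle of radius 1 about `p`
on the axis in two mirror points. Their first coordinate is `(p + 3 / p) / 2`, so their sum is `p +
3 / p` on the axis. -/
theorem inv (hab : a ≠ b) (hf : OnAxis D B a f) (h1 : ∀ y ∈ D, 1 < f y) (h3 : ∀ y ∈ D, f y < 3) :
    OnAxis D B a fun y => (f y)⁻¹ := by
  obtain ⟨p, hp, hpf⟩ := hf.exists_analytic
  replace hf : OnAxis D B a p := hf.congr fun y hy => (hpf y hy).symm
  replace h1 : ∀ y ∈ D, 1 < p y := fun y hy => hpf y hy ▸ h1 y hy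
  replace h3 : ∀ y ∈ D, p y < 3 := fun y hy => hpf y hy ▸ h3 y hy
  refine OnAxis.congr (f := fun y => (p y)⁻¹) ?_ fun y hy => by rw [hpf y hy]
  have hp0 : ∀ y ∈ D, 0 < p y := fun y hy => one_pos.trans (h1 y hy)
  let x : E → ℝ := fun y => (p y ^ 2 + 3) / (2 * p y ^ 2)
  let s : E → ℝ := fun y => (p y - 1) * (3 - p y) * ((p y + 1) * (p y + 3)) / (4 * p y ^ 4)
  have hs : ∀ y ∈ D, 0 < s y := by
    intro y hy
    have := hp0 y hy
    have := sub_pos.2 (h1 y hy)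
    have := sub_pos.2 (h3 y hy)
    positivity
  have hx : AnalyticOnNhd ℝ x D :=
    ((hp.pow 2).add analyticOnNhd_const).div (analyticOnNhd_const.mul (hp.pow 2))
      fun y hy => (mul_pos two_pos (pow_pos (hp0 y hy) 2)).ne'
  have hz : AnalyticOnNhd ℝ (fun y => √(s y)) D := fun y hy =>
    AnalyticAt.sqrt_of_pos (((((hp.sub analyticOnNhd_const).mul (analyticOnNhd_const.sub hp)).mul
      ((hp.add analyticOnNhd_const).mul (hp.add analyticOnNhd_const))).div
      (analyticOnNhd_const.mul (hp.pow 4))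
      fun y hy => (mul_pos four_pos (pow_pos (hp0 y hy) 4)).ne') y hy) (hs y hy)
  have e1 : ∀ y ∈ D, (x y ^ 2 + s y) * (p y ^ 2 + 0 ^ 2) = 2 ^ 2 := by
    intro y hy
    have := (hp0 y hy).ne'
    simp only [x, s]
    field_simp
    ring
  have e2 : ∀ y ∈ D, 2 * x y * (p y ^ 2 + 0 ^ 2) = p y ^ 2 + 0 ^ 2 + 2 ^ 2 - 1 ^ 2 := by
    intro y hy
    have := (hp0 y hy).ne'
    simp only [x]
    field_simp
    ring
  have e3 : ∀ y ∈ D, 0 < √(s y) * p y := fun y hy =>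
    mul_pos (Real.sqrt_pos.2 (hs y hy)) (hp0 y hy)
  have r1 := isRigid_two_circles (c := 1) hab two_pos one_pos (by norm_num)
    (hf.constructible_plane b) hp analyticOnNhd_const hx hz
    (fun y hy => by rw [Real.sq_sqrt (hs y hy).le]; exact e1 y hy) e2
    (fun y hy => by linarith [e3 y hy]) (fun y hy => by linarith [e3 y hy])
  have r2 := isRigid_two_circles (c := -1) (z := fun y => -√(s y)) hab two_pos one_pos
    (by norm_num) (hf.constructible_plane b) hp analyticOnNhd_const hx hz.neg
    (fun y hy => by rw [neg_sq, Real.sq_sqrt (hs y hy).le]; exact e1 y hy) e2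
    (fun y hy => by linarith [e3 y hy]) (fun y hy => by linarith [e3 y hy])
  have hsum : OnAxis D B a fun y => p y + 3 * (p y)⁻¹ := by
    refine ⟨_, add_mem r1.mem_rigidSpan r2.mem_rigidSpan, fun y hy => ?_⟩
    have h2 : 2 * (x y * p y) = p y + 3 * (p y)⁻¹ := by
      have := (hp0 y hy).ne'
      simp only [x]
      field_simp
    simp only [Pi.add_apply]
    rw [← h2]
    module
  exact ((hsum.sub hf).smul (1 / 3)).congr fun y _ => by ring

/-- The unit circles about the origin and about `p` on axis `a` meet at `(p / 2, ±√(4 - p ^ 2) /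
2)`. The difference of these points lies on axis `b`, which is how motion passes from one axis to
another. -/
theorem sqrt_four_sub_sq (hab : a ≠ b) (hf : OnAxis D B a f) (h0 : ∀ y ∈ D, 0 < f y)
    (h2 : ∀ y ∈ D, f y < 2) : OnAxis D B b fun y => √(4 - f y ^ 2) := by
  obtain ⟨p, hp, hpf⟩ := hf.exists_analytic
  replace hf : OnAxis D B a p := hf.congr fun y hy => (hpf y hy).symm
  replace h0 : ∀ y ∈ D, 0 < p y := fun y hy => hpf y hy ▸ h0 y hy
  replace h2 : ∀ y ∈ D, p y < 2 := fun y hy => hpf y hy ▸ h2 y hy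
  refine OnAxis.congr (f := fun y => √(4 - p y ^ 2)) ?_ fun y hy => by rw [hpf y hy]
  have hs : ∀ y ∈ D, 0 < 4 - p y ^ 2 := fun y hy => by nlinarith [h0 y hy, h2 y hy]
  have hz : AnalyticOnNhd ℝ (fun y => √(4 - p y ^ 2) / (2 * p y)) D := by
    refine AnalyticOnNhd.div (fun y hy => ?_) (analyticOnNhd_const.mul hp)
      fun y hy => (mul_pos two_pos (h0 y hy)).ne'
    exact AnalyticAt.sqrt_of_pos ((analyticOnNhd_const.sub (hp.pow 2)) y hy) (hs y hy)
  have e1 : ∀ y ∈ D, ((1 / 2) ^ 2 + (√(4 - p y ^ 2) / (2 * p y)) ^ 2) * (p y ^ 2 + 0 ^ 2) =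
      1 ^ 2 := by
    intro y hy
    rw [div_pow √(4 - p y ^ 2), Real.sq_sqrt (hs y hy).le]
    have := (h0 y hy).ne'
    field_simp
    ring
  have e2 : ∀ y ∈ D, 2 * (1 / 2) * (p y ^ 2 + 0 ^ 2) = p y ^ 2 + 0 ^ 2 + 1 ^ 2 - 1 ^ 2 := by
    intro y hy; ring
  have e3 : ∀ y ∈ D, 0 < √(4 - p y ^ 2) / (2 * p y) * p y := fun y hy =>
    mul_pos (div_pos (Real.sqrt_pos.2 (hs y hy)) (mul_pos two_pos (h0 y hy))) (h0 y hy)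
  have r1 := isRigid_two_circles (c := 1) (x := fun _ => 1 / 2) hab one_pos one_pos (by norm_num)
    (hf.constructible_plane b) hp analyticOnNhd_const analyticOnNhd_const hz e1 e2
    (fun y hy => by linarith [e3 y hy]) (fun y hy => by linarith [e3 y hy])
  have r2 := isRigid_two_circles (c := -1) (x := fun _ => 1 / 2)
    (z := fun y => -(√(4 - p y ^ 2) / (2 * p y))) hab one_pos one_pos
    (by norm_num) (hf.constructible_plane b) hp analyticOnNhd_const analyticOnNhd_const hz.neg
    (fun y hy => by rw [neg_sq]; exact e1 y hy) e2
    (fun y hy => by linarith [e3 y hy]) (fun y hy => by linarith [e3 y hy])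
  refine ⟨_, sub_mem r1.mem_rigidSpan r2.mem_rigidSpan, fun y hy => ?_⟩
  have h2 : √(4 - p y ^ 2) = 2 * (√(4 - p y ^ 2) / (2 * p y) * p y) := by
    have := (h0 y hy).ne'
    field_simp
  trans (2 * (√(4 - p y ^ 2) / (2 * p y) * p y)) • EuclideanSpace.single b (1 : ℝ)
  · simp only [Pi.sub_apply]
    module
  · rw [← h2]

/-- For a scaled `g = ε * f`, twice `1 / (2 - g) + 1 / (2 + g)` is `8 / (4 - g ^ 2)`, whose inverse
is `1 / 2 - g ^ 2 / 8`. The bound `|g| ≤ 1 / 2` keeps every inverted quantity between 1 and 3. -/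
theorem sq (hD : IsCompact D) (hab : a ≠ b) (hf : OnAxis D B a f) :
    OnAxis D B a fun y => f y ^ 2 := by
  obtain ⟨ε, hε, hb⟩ := hf.exists_scale hD
  have hg := hf.smul ε
  have hb' : ∀ y ∈ D, -(1 / 2) ≤ ε * f y ∧ ε * f y ≤ 1 / 2 := fun y hy => abs_le.1 (hb y hy)
  have i1 := ((const 2).sub hg).inv hab (fun y hy => by linarith [hb' y hy])
    (fun y hy => by linarith [hb' y hy])
  have i2 := ((const 2).add hg).inv hab (fun y hy => by linarith [hb' y hy])
    (fun y hy => by linarith [hb' y hy])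
  have hpos : ∀ y ∈ D, 0 < 4 - (ε * f y) ^ 2 := fun y hy => by nlinarith [hb' y hy]
  have hs : OnAxis D B a fun y => 8 / (4 - (ε * f y) ^ 2) := by
    refine ((i1.add i2).smul 2).congr fun y hy => ?_
    have h1 : 2 - ε * f y ≠ 0 := by linarith [hb' y hy]
    have h2 : 2 + ε * f y ≠ 0 := by linarith [hb' y hy]
    have h3 : 4 - ε ^ 2 * f y ^ 2 ≠ 0 := by rw [← mul_pow]; exact (hpos y hy).ne'
    field_simp
    ring
  have i3 := hs.inv hab
    (fun y hy => by rw [lt_div_iff₀ (hpos y hy)]; nlinarith [hb' y hy])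
    (fun y hy => by rw [div_lt_iff₀ (hpos y hy)]; nlinarith [hb' y hy])
  refine ((((const (1 / 2)).sub i3).smul (8 / ε ^ 2))).congr fun y hy => ?_
  rw [inv_div]
  field_simp
  ring

theorem mul (hD : IsCompact D) (hab : a ≠ b) (hf : OnAxis D B a f) (hg : OnAxis D B a g) :
    OnAxis D B a fun y => f y * g y :=
  ((((hf.add hg).sq hD hab).sub ((hf.sub hg).sq hD hab)).smul (1 / 4)).congr fun y _ => by ring

/-- Squaring `√(4 - p ^ 2)` on axis `b` gives `4 - p ^ 2` there; for `p = 1 - g` and `p = 1 + g` the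
difference is `4 * g`. -/
theorem change_axis (hD : IsCompact D) (hab : a ≠ b) (hf : OnAxis D B a f) : OnAxis D B b f := by
  obtain ⟨ε, hε, hb⟩ := hf.exists_scale hD
  have hb' : ∀ y ∈ D, -(1 / 2) ≤ ε * f y ∧ ε * f y ≤ 1 / 2 := fun y hy => abs_le.1 (hb y hy)
  have hg := hf.smul ε
  have key : ∀ {p : E → ℝ}, OnAxis D B a p → (∀ y ∈ D, 0 < p y ∧ p y < 2) →
      OnAxis D B b fun y => 4 - p y ^ 2 := by
    intro p hp hpb
    refine ((hp.sqrt_four_sub_sq hab (fun y hy => (hpb y hy).1)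
      (fun y hy => (hpb y hy).2)).sq hD hab.symm).congr fun y hy => ?_
    rw [Real.sq_sqrt]
    nlinarith [hpb y hy]
  have k1 := key ((const 1).add hg) fun y hy => by constructor <;> linarith [hb' y hy]
  have k2 := key ((const 1).sub hg) fun y hy => by constructor <;> linarith [hb' y hy]
  refine ((k2.sub k1).smul (1 / (4 * ε))).congr fun y _ => ?_
  field_simp
  ring

/-- The Peaucellier inversor: it turns motion on an arc of a circle into motion on a segment. -/
theorem of_arc (hab : a ≠ b) {t : E → ℝ} (ht : AnalyticOnNhd ℝ t D) (htb : ∀ y ∈ D, |t y| ≤ 3 / 4)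
    (hB : (fun y => ((1 - t y ^ 2) / (1 + t y ^ 2)) • EuclideanSpace.single a (1 : ℝ) +
      (2 * t y / (1 + t y ^ 2)) • EuclideanSpace.single b (1 : ℝ)) ∈ B) : OnAxis D B b t := by
  have hd : ∀ y, 0 < 1 + t y ^ 2 := fun y => by positivity
  have hda : AnalyticOnNhd ℝ (fun y => 1 + t y ^ 2) D := analyticOnNhd_const.add (ht.pow 2)
  have hp₁ : AnalyticOnNhd ℝ (fun y => 2 / (1 + t y ^ 2)) D :=
    analyticOnNhd_const.div hda fun y _ => (hd y).ne'
  have hp₂ : AnalyticOnNhd ℝ (fun y => 2 * t y / (1 + t y ^ 2)) D :=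
    (analyticOnNhd_const.mul ht).div hda fun y _ => (hd y).ne'
  have hv : IsRigid D B (fun y => ((1 - t y ^ 2) / (1 + t y ^ 2)) •
      EuclideanSpace.single a (1 : ℝ) +
      (2 * t y / (1 + t y ^ 2)) • EuclideanSpace.single b (1 : ℝ)) := by
    refine ⟨Constructible.of_mem hB, ?_, 1, one_pos, fun y hy => ?_⟩
    · exact (((analyticOnNhd_const.sub (ht.pow 2)).div hda fun y _ => (hd y).ne').smul
        analyticOnNhd_const).add (hp₂.smul analyticOnNhd_const)
    · rw [← sq_eq_sq₀ (norm_nonneg _) zero_le_one, EuclideanSpace.norm_sq_plane hab]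
      have := (hd y).ne'
      field_simp
      ring
  have hPmem := add_mem (const_mem_rigidSpan (D := D) (B := B) (EuclideanSpace.single a (1 : ℝ)))
    hv.mem_rigidSpan
  have hPeq : ((fun _ => EuclideanSpace.single a (1 : ℝ)) + fun y =>
      ((1 - t y ^ 2) / (1 + t y ^ 2)) • EuclideanSpace.single a (1 : ℝ) +
      (2 * t y / (1 + t y ^ 2)) • EuclideanSpace.single b (1 : ℝ)) =
      fun y => (2 / (1 + t y ^ 2)) • EuclideanSpace.single a (1 : ℝ) +
      (2 * t y / (1 + t y ^ 2)) • EuclideanSpace.single b (1 : ℝ) := by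
    funext y
    have : 2 / (1 + t y ^ 2) = 1 + (1 - t y ^ 2) / (1 + t y ^ 2) := by
      have := (hd y).ne'
      field_simp
      ring
    rw [this, Pi.add_apply]
    module
  rw [hPeq] at hPmem
  have hP := constructible_of_mem_rigidSpan hPmem
  have ht2 : ∀ y ∈ D, t y ^ 2 ≤ 9 / 16 := fun y hy => by
    have := pow_le_pow_left₀ (abs_nonneg _) (htb y hy) 2
    rw [sq_abs] at this
    linarith
  let s : E → ℝ := fun y => 1 + t y ^ 2 - t y ^ 4 / 4
  -- This inequality puts the two circle intersections strictly on opposite sides of axis `a`, so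
  -- that cables can tell them apart. It relies on `|t| ≤ 3 / 4`.
  have hs : ∀ y ∈ D, ((1 + t y ^ 2 / 2) * t y) ^ 2 < s y := by
    intro y hy
    have h1 := ht2 y hy
    have h0 := sq_nonneg (t y)
    simp only [s]
    have : t y ^ 2 * t y ^ 2 ≤ 9 / 16 * (9 / 16) := mul_le_mul h1 h1 h0 (by norm_num)
    have : t y ^ 2 * t y ^ 2 * t y ^ 2 ≤ 9 / 16 * (9 / 16) * (9 / 16) :=
      mul_le_mul this h1 h0 (by norm_num)
    linarith
  have hs0 : ∀ y ∈ D, 0 < s y := fun y hy => (sq_nonneg _).trans_lt (hs y hy)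
  have hx : AnalyticOnNhd ℝ (fun y => 1 + t y ^ 2 / 2) D :=
    analyticOnNhd_const.add ((ht.pow 2).div analyticOnNhd_const fun _ _ => two_ne_zero)
  have hz : AnalyticOnNhd ℝ (fun y => √(s y)) D := fun y hy =>
    AnalyticAt.sqrt_of_pos ((hda.sub ((ht.pow 4).div analyticOnNhd_const
      fun _ _ => four_ne_zero)) y hy) (hs0 y hy)
  have h8 : (√8 : ℝ) ^ 2 = 8 := Real.sq_sqrt (by norm_num)
  have e1 : ∀ y ∈ D, ((1 + t y ^ 2 / 2) ^ 2 + s y) *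
      ((2 / (1 + t y ^ 2)) ^ 2 + (2 * t y / (1 + t y ^ 2)) ^ 2) = √8 ^ 2 := by
    intro y _
    have := (hd y).ne'
    rw [h8]
    simp only [s]
    field_simp
    ring
  have e2 : ∀ y ∈ D, 2 * (1 + t y ^ 2 / 2) *
      ((2 / (1 + t y ^ 2)) ^ 2 + (2 * t y / (1 + t y ^ 2)) ^ 2) =
      (2 / (1 + t y ^ 2)) ^ 2 + (2 * t y / (1 + t y ^ 2)) ^ 2 + √8 ^ 2 - 2 ^ 2 := by
    intro y _
    have := (hd y).ne'
    rw [h8]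
    field_simp
    ring
  have hlt : ∀ y ∈ D, -√(s y) < (1 + t y ^ 2 / 2) * t y ∧ (1 + t y ^ 2 / 2) * t y < √(s y) :=
    fun y hy => abs_lt.1 (Real.lt_sqrt (abs_nonneg _) |>.2 (by rw [sq_abs]; exact hs y hy))
  have e3 : ∀ y ∈ D, 0 < (1 + t y ^ 2 / 2) * (2 * t y / (1 + t y ^ 2)) +
      √(s y) * (2 / (1 + t y ^ 2)) := by
    intro y hy
    rw [show (1 + t y ^ 2 / 2) * (2 * t y / (1 + t y ^ 2)) + √(s y) * (2 / (1 + t y ^ 2)) =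
      ((1 + t y ^ 2 / 2) * t y + √(s y)) * (2 / (1 + t y ^ 2)) by ring]
    exact mul_pos (by linarith [hlt y hy]) (div_pos two_pos (hd y))
  have e4 : ∀ y ∈ D, (1 + t y ^ 2 / 2) * (2 * t y / (1 + t y ^ 2)) -
      √(s y) * (2 / (1 + t y ^ 2)) < 0 := by
    intro y hy
    rw [show (1 + t y ^ 2 / 2) * (2 * t y / (1 + t y ^ 2)) - √(s y) * (2 / (1 + t y ^ 2)) =
      ((1 + t y ^ 2 / 2) * t y - √(s y)) * (2 / (1 + t y ^ 2)) by ring]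
    exact mul_neg_of_neg_of_pos (by linarith [hlt y hy]) (div_pos two_pos (hd y))
  have r1 := isRigid_two_circles (c := 1) hab (Real.sqrt_pos.2 (by norm_num : (0 : ℝ) < 8))
    two_pos (by norm_num) hP hp₁ hp₂ hx hz
    (fun y hy => by rw [Real.sq_sqrt (hs0 y hy).le]; exact e1 y hy) e2
    (fun y hy => by linarith [e3 y hy]) (fun y hy => by linarith [e4 y hy])
  have r2 := isRigid_two_circles (c := -1) (z := fun y => -√(s y)) hab
    (Real.sqrt_pos.2 (by norm_num : (0 : ℝ) < 8))
    two_pos (by norm_num) hP hp₁ hp₂ hx hz.neg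
    (fun y hy => by rw [neg_sq, Real.sq_sqrt (hs0 y hy).le]; exact e1 y hy) e2
    (fun y hy => by linarith [e4 y hy]) (fun y hy => by linarith [e3 y hy])
  -- The rhombus of side 2 with opposite vertices `P` and `W₁ + W₂ - P` realizes inversion of power
  -- `8 - 4 = 4`. As `P` runs on a circle through the origin, its inverse `(1 + t ^ 2) P = (2, 2 *
  -- t)` runs on a line.
  have hQ : OnAxis D B b fun y => 2 * t y := by
    refine ⟨_, sub_mem (sub_mem (add_mem r1.mem_rigidSpan r2.mem_rigidSpan) hPmem)
      (const_mem_rigidSpan ((2 : ℝ) • EuclideanSpace.single a (1 : ℝ))), fun y hy => ?_⟩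
    have h1 : (1 + t y ^ 2) * (2 / (1 + t y ^ 2)) = 2 := by
      have := (hd y).ne'
      field_simp
    have h2 : 2 * t y = (1 + t y ^ 2) * (2 * t y / (1 + t y ^ 2)) := by
      have := (hd y).ne'
      field_simp
    trans ((1 + t y ^ 2) * (2 / (1 + t y ^ 2)) - 2) • EuclideanSpace.single a (1 : ℝ) +
      ((1 + t y ^ 2) * (2 * t y / (1 + t y ^ 2))) • EuclideanSpace.single b (1 : ℝ)
    · simp only [Pi.add_apply, Pi.sub_apply]
      module
    · rw [h1, ← h2]
      simp
  exact (hQ.smul (1 / 2)).congr fun y _ => by ring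

end OnAxis

end Gadgets

/-! ### The initial linkage: points on arcs, parametrized by a cube. -/

section Arc

variable {n : ℕ} {a b : Fin n}

/-- Rational parametrization of the unit circle in a coordinate plane. -/
noncomputable def circlePoint (a b : Fin n) (t : ℝ) : EuclideanSpace ℝ (Fin n) :=
  ((1 - t ^ 2) / (1 + t ^ 2)) • EuclideanSpace.single a (1 : ℝ) +
    (2 * t / (1 + t ^ 2)) • EuclideanSpace.single b (1 : ℝ)

theorem norm_circlePoint (hab : a ≠ b) (t : ℝ) : ‖circlePoint a b t‖ = 1 := by
  rw [← sq_eq_sq₀ (norm_nonneg _) zero_le_one, circlePoint, EuclideanSpace.norm_sq_plane hab]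
  have : 1 + t ^ 2 ≠ 0 := by positivity
  field_simp
  ring

theorem AnalyticAt.circlePoint {E : Type*} [NormedAddCommGroup E] [NormedSpace ℝ E] {t : E → ℝ}
    {x : E} (ht : AnalyticAt ℝ t x) (a b : Fin n) :
    AnalyticAt ℝ (fun y => circlePoint a b (t y)) x := by
  have hd : AnalyticAt ℝ (fun y => 1 + t y ^ 2) x := analyticAt_const.add (ht.pow 2)
  have hd0 : 1 + t x ^ 2 ≠ 0 := by positivity
  exact (((analyticAt_const.sub (ht.pow 2)).div hd hd0).smul analyticAt_const).add
    (((analyticAt_const.mul ht).div hd hd0).smul analyticAt_const)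

/-- For a unit vector, distance `√2` from a basis vector kills that coordinate, and the cable says
`w a ≥ 7 / 25`, the value of `(1 - t ^ 2) / (1 + t ^ 2)` at `t = 3 / 4`. The parameter `w b / (1 + w
a)` is stereographic projection. -/
theorem exists_circlePoint_iff (hab : a ≠ b) (w : EuclideanSpace ℝ (Fin n)) :
    (‖w - 0‖ = 1 ∧ (∀ j : {j // j ≠ a ∧ j ≠ b}, ‖w - EuclideanSpace.single j.1 (1 : ℝ)‖ = √2) ∧
      ‖w - EuclideanSpace.single a (1 : ℝ)‖ ≤ 6 / 5) ↔
    ∃ t : ℝ, |t| ≤ 3 / 4 ∧ w = circlePoint a b t := by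
  have hsq : ∀ (w : EuclideanSpace ℝ (Fin n)) i,
      ‖w - EuclideanSpace.single i (1 : ℝ)‖ ^ 2 = ‖w‖ ^ 2 - 2 * w i + 1 := by
    intro w i
    have := EuclideanSpace.norm_sub_single_sq w i 1
    rw [one_smul] at this
    rw [this]
    ring
  have h2 : (√2 : ℝ) ^ 2 = 2 := Real.sq_sqrt (by norm_num)
  rw [sub_zero]
  constructor
  · rintro ⟨h1, h3, h4⟩
    have hwi : ∀ i, i ≠ a → i ≠ b → w i = 0 := by
      intro i hi hi'
      have := h3 ⟨i, hi, hi'⟩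
      rw [← sq_eq_sq₀ (norm_nonneg _) (Real.sqrt_nonneg _), hsq, h1, h2] at this
      linarith
    have hw := EuclideanSpace.eq_plane hab hwi
    have hu : 7 / 25 ≤ w a := by
      have := pow_le_pow_left₀ (norm_nonneg _) h4 2
      rw [hsq, h1] at this
      linarith
    have huv : w a ^ 2 + w b ^ 2 = 1 := by
      rw [← EuclideanSpace.norm_sq_plane hab, ← hw, h1, one_pow]
    have h0 : 1 + w a ≠ 0 := by linarith
    have ht2 : (w b / (1 + w a)) ^ 2 = (1 - w a) / (1 + w a) := by
      rw [div_pow, div_eq_div_iff (pow_ne_zero 2 h0) h0]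
      linear_combination (1 + w a) * huv
    refine ⟨w b / (1 + w a), abs_le_of_sq_le_sq ?_ (by norm_num), ?_⟩
    · rw [ht2, div_le_iff₀ (by linarith)]
      linarith
    · have hd : 1 + (1 - w a) / (1 + w a) = 2 / (1 + w a) := by field_simp; ring
      have e1 : (1 - (1 - w a) / (1 + w a)) / (2 / (1 + w a)) = w a := by field_simp; ring
      have e2 : 2 * (w b / (1 + w a)) / (2 / (1 + w a)) = w b := by field_simp
      rw [circlePoint, ht2, hd, e1, e2]
      exact hw
  · rintro ⟨t, ht, rfl⟩
    have hn := norm_circlePoint hab t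
    have ht2 : t ^ 2 ≤ 9 / 16 := by
      have := pow_le_pow_left₀ (abs_nonneg _) ht 2
      rw [sq_abs] at this
      linarith
    refine ⟨hn, fun j => ?_, ?_⟩
    · rw [← sq_eq_sq₀ (norm_nonneg _) (Real.sqrt_nonneg _), hsq, hn, h2]
      have : circlePoint a b t j.1 = 0 := by simp [circlePoint, j.2.1, j.2.2]
      rw [this]
      norm_num
    · refine le_of_sq_le_sq ?_ (by norm_num)
      have hd : 0 < 1 + t ^ 2 := by positivity
      have : circlePoint a b t a = (1 - t ^ 2) / (1 + t ^ 2) := by simp [circlePoint, hab]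
      rw [hsq, hn, this]
      have : 7 / 25 ≤ (1 - t ^ 2) / (1 + t ^ 2) := by rw [le_div_iff₀ hd]; linarith
      linarith

/-- A linkage whose configuration space is a cube: every coordinate moves a point on an arc. -/
theorem exists_realizes_cube (hab : a ≠ b) (N : ℕ) {R : ℝ} (hR : 0 < R) :
    ∃ γ : Fin N ⊕ Option (Fin n) → (Fin N → ℝ) → EuclideanSpace ℝ (Fin n),
      Realizes (Metric.closedBall 0 R) γ ∧
      ∀ i, γ (Sum.inl i) = fun y => circlePoint a b (3 / (4 * R) * y i) := by
  let fx : Option (Fin n) → EuclideanSpace ℝ (Fin n) := fun o =>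
    o.elim 0 fun j => EuclideanSpace.single j 1
  refine ⟨Sum.elim (fun i y => circlePoint a b (3 / (4 * R) * y i)) fun o _ => fx o,
    ⟨?_, ?_⟩, fun i => rfl⟩
  · convert (IsLinkageSet.iInter fun o => IsLinkageSet.fix
      (Sum.inr o : Fin N ⊕ Option (Fin n)) (fx o)).inter
      (IsLinkageSet.iInter fun i : Fin N =>
        (IsLinkageSet.rod (n := n) (Sum.inl i) (Sum.inr none) one_pos).inter
        ((IsLinkageSet.iInter fun j : {j // j ≠ a ∧ j ≠ b} =>
          IsLinkageSet.rod (Sum.inl i) (Sum.inr (some j.1)) (Real.sqrt_pos.2 two_pos)).inter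
        (IsLinkageSet.cable (Sum.inl i) (Sum.inr (some a))
          (by norm_num : (0 : ℝ) < 6 / 5)))) using 1
    ext φ
    simp only [Set.mem_inter_iff, Set.mem_iInter, Set.mem_ofPred_eq]
    constructor
    · rintro ⟨y, hy, rfl⟩
      refine ⟨fun o => rfl, fun i => (exists_circlePoint_iff hab _).2 ⟨_, ?_, rfl⟩⟩
      rw [mem_closedBall_zero_iff, pi_norm_le_iff_of_nonneg hR.le] at hy
      have := hy i
      rw [Real.norm_eq_abs] at this
      rw [abs_mul, abs_of_pos (by positivity), div_mul_eq_mul_div, div_le_iff₀ (by positivity)]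
      linarith
    · rintro ⟨h1, h2⟩
      have h3 : ∀ i, ∃ t : ℝ, |t| ≤ 3 / 4 ∧ φ (Sum.inl i) = circlePoint a b t := by
        intro i
        have := h2 i
        simp only [h1] at this
        exact (exists_circlePoint_iff hab _).1 this
      choose t ht htφ using h3
      refine ⟨fun i => 4 * R / 3 * t i, ?_, ?_⟩
      · rw [mem_closedBall_zero_iff, pi_norm_le_iff_of_nonneg hR.le]
        intro i
        rw [Real.norm_eq_abs, abs_mul, abs_of_pos (by positivity)]
        have := mul_le_mul_of_nonneg_left (ht i) (by positivity : 0 ≤ 4 * R / 3)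
        linarith
      · funext v
        rcases v with i | o
        · have : 3 / (4 * R) * (4 * R / 3 * t i) = t i := by field_simp
          simp only [Sum.elim_inl, this]
          exact (htφ i).symm
        · exact (h1 o).symm
  · rintro (i | o)
    · intro y _
      exact (analyticAt_const.mul
        ((ContinuousLinearMap.proj (R := ℝ) (φ := fun _ : Fin N => ℝ) i).analyticAt y)).circlePoint
        a b
    · exact analyticOnNhd_const

end Arc

/-! ### Polynomial maps and polynomial inequalities. -/

section Polynomials

variable {n N : ℕ} {a b : Fin n} {D : Set (Fin N → ℝ)}
  {B : Set ((Fin N → ℝ) → EuclideanSpace ℝ (Fin n))}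

theorem OnAxis.eval (hD : IsCompact D) (hab : a ≠ b) (h : ∀ i, OnAxis D B a fun y => y i)
    (p : MvPolynomial (Fin N) ℝ) (j : Fin n) :
    OnAxis D B j fun y => MvPolynomial.eval y p := by
  have ha : OnAxis D B a fun y => MvPolynomial.eval y p := by
    induction p using MvPolynomial.induction_on with
    | C c => simpa using OnAxis.const c
    | add p q hp hq => simpa using hp.add hq
    | mul_X p i hp => simpa using hp.mul hD hab (h i)
  by_cases hj : a = j
  · exact hj ▸ ha
  · exact ha.change_axis hD hj

theorem constructible_of_onAxis {f : Fin n → (Fin N → ℝ) → ℝ} (hf : ∀ j, OnAxis D B j (f j)) :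
    Constructible D B fun y => WithLp.toLp 2 fun j => f j y := by
  choose F hF hFf using hf
  refine (constructible_of_mem_rigidSpan (sum_mem fun j (_ : j ∈ Finset.univ) => hF j)).congr
    fun y hy => ?_
  ext i
  rw [Finset.sum_apply, WithLp.ofLp_sum, Finset.sum_apply]
  rw [Finset.sum_congr rfl fun j _ => by rw [hFf j y hy]]
  simp

/-- Polynomial maps on a bounded set given by finitely many polynomial inequalities are vertex
maps of a linkage parametrized by this set. -/
theorem exists_linkage_of_polynomials (hn : 2 ≤ n) {ι κ : Type} [Finite ι] [Finite κ]
    (c : ι → MvPolynomial (Fin N) ℝ) (P : κ → Fin n → MvPolynomial (Fin N) ℝ)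
    {Y : Set (Fin N → ℝ)} (hY : Y = {y | ∀ i, 0 ≤ MvPolynomial.eval y (c i)})
    (hb : Bornology.IsBounded Y) (hne : Y.Nonempty) :
    ∃ (L : CabledLinkage n) (Φ : (Fin N → ℝ) → L.Vert → EuclideanSpace ℝ (Fin n))
      (v : κ → L.Vert), AnalyticOnNhd ℝ Φ Y ∧ L.config = Φ '' Y ∧
      ∀ y ∈ Y, ∀ i j, Φ y (v i) j = MvPolynomial.eval y (P i j) := by
  let a : Fin n := ⟨0, by omega⟩
  let b : Fin n := ⟨1, by omega⟩
  have hab : a ≠ b := by simp [a, b]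
  obtain ⟨R, hR, hYR⟩ := hb.subset_closedBall_lt 0 0
  obtain ⟨γ, hγ, hγi⟩ := exists_realizes_cube hab N hR
  set D : Set (Fin N → ℝ) := Metric.closedBall 0 R with hDdef
  have hD : IsCompact D := isCompact_closedBall 0 R
  have hax : ∀ i, OnAxis D (Set.range γ) b fun y => y i := by
    intro i
    have han : AnalyticOnNhd ℝ (fun y : Fin N → ℝ => 3 / (4 * R) * y i) D := fun y _ =>
      analyticAt_const.mul
        ((ContinuousLinearMap.proj (R := ℝ) (φ := fun _ : Fin N => ℝ) i).analyticAt y)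
    refine ((OnAxis.of_arc (B := Set.range γ) hab han (fun y hy => ?_) ⟨Sum.inl i, hγi i⟩).smul
      (4 * R / 3)).congr fun y _ => by field_simp
    rw [hDdef, mem_closedBall_zero_iff, pi_norm_le_iff_of_nonneg hR.le] at hy
    have := hy i
    rw [Real.norm_eq_abs] at this
    rw [abs_mul, abs_of_pos (by positivity), div_mul_eq_mul_div, div_le_iff₀ (by positivity)]
    linarith
  have hbd : ∀ i, ∃ M : ℝ, 0 < M ∧ ∀ y ∈ D, MvPolynomial.eval y (c i) ≤ M := by
    intro i
    obtain ⟨M, hM⟩ := hD.exists_bound_of_continuousOn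
      (MvPolynomial.continuous_eval (c i)).continuousOn
    refine ⟨|M| + 1, by positivity, fun y hy => ?_⟩
    linarith [le_abs_self (MvPolynomial.eval y (c i)), hM y hy, le_abs_self M,
      Real.norm_eq_abs (MvPolynomial.eval y (c i))]
  choose M hM hcM using hbd
  obtain ⟨V, hV, γ', ⟨hγ', han⟩, -, hvert⟩ := Constructible.exists_family
    (g := Sum.elim (fun i => fun y => WithLp.toLp 2 fun j => MvPolynomial.eval y (P i j))
      (Sum.elim (fun i => fun y => MvPolynomial.eval y (c i) • EuclideanSpace.single b (1 : ℝ))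
        fun i => fun _ => M i • EuclideanSpace.single b (1 : ℝ)))
    (by
      rintro (i | i | i)
      · exact constructible_of_onAxis fun j => OnAxis.eval hD hab.symm hax (P i j) j
      · exact (OnAxis.eval hD hab.symm hax (c i) b).constructible
      · exact Constructible.const _) hγ (by rintro _ ⟨v, rfl⟩; exact ⟨v, fun _ _ => rfl⟩)
  choose v hv using hvert
  -- On `D` one has `c i ≤ M i`, so a cable of length `M i` between `c i` and `M i` on axis `b` says
  -- exactly `0 ≤ c i`.
  have hS := hγ'.inter (IsLinkageSet.iInter fun i => IsLinkageSet.cable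
    (v (Sum.inr (Sum.inl i))) (v (Sum.inr (Sum.inr i))) (hM i))
  have hSY : ((fun y v => γ' v y) '' D) ∩ (⋂ i, {φ | ‖φ (v (Sum.inr (Sum.inl i))) -
      φ (v (Sum.inr (Sum.inr i)))‖ ≤ M i}) = (fun y v => γ' v y) '' Y := by
    have key : ∀ y ∈ D, (∀ i, ‖γ' (v (Sum.inr (Sum.inl i))) y -
        γ' (v (Sum.inr (Sum.inr i))) y‖ ≤ M i) ↔ y ∈ Y := by
      intro y hy
      rw [hY, Set.mem_ofPred_eq]
      refine forall_congr' fun i => ?_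
      rw [hv _ hy, hv _ hy]
      simp only [Sum.elim_inl, Sum.elim_inr]
      rw [← sub_smul, norm_smul, PiLp.norm_single, norm_one, mul_one, Real.norm_eq_abs,
        abs_le]
      have := hcM i y hy
      have := hM i
      constructor
      · intro h; linarith
      · intro h; constructor <;> linarith
    ext φ
    simp only [Set.mem_inter_iff, Set.mem_iInter, Set.mem_ofPred_eq]
    constructor
    · rintro ⟨⟨y, hy, rfl⟩, h⟩
      exact ⟨y, (key y hy).1 h, rfl⟩
    · rintro ⟨y, hy, rfl⟩
      exact ⟨⟨y, hYR hy, rfl⟩, (key y (hYR hy)).2 hy⟩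
  rw [hSY] at hS
  have := Fintype.ofFinite V
  obtain ⟨L, e, hL⟩ := hS.exists_linkage (hne.image _)
  refine ⟨L, fun y u => γ' (e.symm u) y, fun i => e (v (Sum.inl i)), ?_, ?_, ?_⟩
  · exact analyticOnNhd_pi_iff.2 fun u y hy => han _ y (hYR hy)
  · rw [hL]
    ext φ
    constructor
    · rintro ⟨y, hy, h⟩
      refine ⟨y, hy, funext fun u => ?_⟩
      have := congrFun h (e.symm u)
      simpa using this
    · rintro ⟨y, hy, rfl⟩
      exact ⟨y, hy, funext fun u => by simp⟩
  · intro y hy i j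
    simp only [Equiv.symm_apply_apply]
    rw [hv _ (hYR hy)]
    rfl

end Polynomials

/-! ### The equivalence, with the empty case apart. -/

/-- A rod of length 1 joins two vertices pinned at the origin. This covers empty `Y`, where no
sample configuration is available to reconcile constraints. -/
theorem exists_linkage_config_empty (n : ℕ) : ∃ L : CabledLinkage n, Nonempty L.Vert ∧
    L.config = ∅ := by
  refine ⟨⟨Bool, ⊤, fun _ => 1, fun _ => one_pos, Set.univ, fun _ => 0, ∅⟩, ⟨true⟩, ?_⟩
  refine Set.eq_empty_of_forall_notMem ?_
  rintro φ ⟨h1, h2⟩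
  have h3 : ∀ v, φ v = 0 := fun v => h1 ⟨v, Set.mem_univ v⟩
  have h4 : ‖φ true - φ false‖ = 1 :=
    (h2 true false (by simp)).2 (Set.notMem_empty _)
  rw [h3, h3] at h4
  simp at h4

theorem mainTheorem11 (n : ℕ) (hn : 2 ≤ n) (k m : ℕ)
    (X : Set (Fin k → EuclideanSpace ℝ (Fin n))) (hX : IsCompact X)
    (f : X → Fin m → EuclideanSpace ℝ (Fin n)) :
    (∃ L : CabledLinkage n, L.IsStronglyFunctional f) ↔
      ∃ (N : ℕ) (Y : Set (Fin N → ℝ)) (q : Y → X) (p : Y → Fin m → EuclideanSpace ℝ (Fin n)),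
        IsQuasialgebraic Y ∧
        IsPolynomialMap (fun y => (q y : Fin k → EuclideanSpace ℝ (Fin n))) ∧
        IsPolynomialMap p ∧
        p = f ∘ q ∧
        IsAnalyticIso q := by
  constructor
  · rintro ⟨L, hL⟩
    exact hL.exists_quasialgebraic
  · rintro ⟨N, Y, q, p, ⟨P, Q, hY⟩, ⟨qp, hqp⟩, ⟨pp, hpp⟩, rfl, hq⟩
    rcases Y.eq_empty_or_nonempty with hemp | hne
    · obtain ⟨L, ⟨v⟩, hL⟩ := exists_linkage_config_empty n
      subst hemp
      exact ⟨L, L.isStronglyFunctional_of_image (Φ := fun _ _ => 0) (w := fun _ => v)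
        (v := fun _ => v) hq (by simp [AnalyticOnNhd]) (by rw [hL, Set.image_empty])
        (fun y => y.2.elim) (fun y => y.2.elim)⟩
    -- Compactness of `X` enters here, through the homeomorphism `q`.
    · have hYb : Bornology.IsBounded Y := by
        obtain ⟨h, -⟩ := hq
        have := isCompact_iff_compactSpace.1 hX
        exact (isCompact_iff_compactSpace.2 h.symm.compactSpace).isBounded
      obtain ⟨L, Φ, v, hΦ, hL, hv⟩ := exists_linkage_of_polynomials hn
        -- An equation is split into the two inequalities for `i` and `-i`.
        (Sum.elim (fun i : P => (i : MvPolynomial (Fin N) ℝ))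
          (Sum.elim (fun i : P => -(i : MvPolynomial (Fin N) ℝ)) fun i : Q => i.1))
        (Sum.elim qp pp) (Y := Y) (by
          rw [hY]
          ext y
          simp only [Set.mem_ofPred_eq, Sum.forall, Sum.elim_inl, Sum.elim_inr, map_neg,
            Subtype.forall]
          constructor
          · rintro ⟨h1, h2⟩
            exact ⟨fun i hi => (h1 i hi).ge, fun i hi => by rw [h1 i hi, neg_zero], h2⟩
          · rintro ⟨h1, h2, h3⟩
            exact ⟨fun i hi => le_antisymm (neg_nonneg.1 (h2 i hi)) (h1 i hi), h3⟩) hYb hne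
      refine ⟨L, L.isStronglyFunctional_of_image hq hΦ hL (w := fun i => v (Sum.inl i))
        (v := fun i => v (Sum.inr i)) ?_ ?_⟩
      · intro y i
        ext j
        rw [hv y y.2, hqp y i j, Sum.elim_inl]
      · intro y i
        ext j
        rw [hv y y.2, Sum.elim_inr, ← hpp y i j, Function.comp]
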